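/- Let $K$ be an infinite field of characteristic different from $2$ and $3$; all associative algebras are over $K$ and have a unit. Let $F$ be the free associative algebra on $x_1,x_2,\dots$, and for $n\ge 2$ put $[x_1,x_2]=x_1x_2-x_2x_1$, $[x_1,\dots,x_n]=[[x_1,\dots,x_{n-1}],x_n]$. Let $T^{(n)}$ be the T-ideal of $F$ (ideal stable under all endomorphisms of $F$) generated by $[x_1,\dots,x_n]$, let $F^{(n)}=F/T^{(n)}$, and let $F_3^{(n)}$ be the subalgebra of $F^{(n)}$ generated by the images of $x_1,x_2,x_3$. Let $F_3$ and $L_3$ be the free associative algebra and the free Lie algebra on three generators, and let $(e_\alpha)$ be a basis of $L_3$ consisting of homogeneous elements, with a linear order on the indices such that $\alpha<\beta$ whenever $\deg e_\alpha>\deg e_\beta$. A regular word is a product $v=e_{i_1}e_{i_2}\cdots e_{i_t}$ in $F_3$ with $t\ge 0$ and $i_1\le\dots\le i_t$ (the empty product being $1$); its weight is $\mathrm{wt}(v)=\sum_{j}\deg(e_{i_j})-t+1$. Then the regular words form a basis of the vector space $F_3$. Define the weight $\mathrm{wt}(f)$ of $f\in F_3$ as the least weight of the regular words occurring with nonzero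 coefficient in the expansion of $f$ in this basis ($\mathrm{wt}(0)=\infty$). For every $n\ge 2$ and every $f=f(x,y,z)\in F_3$: $f=0$ is an identity of $F^{(n)}$ (that is, $f(a,b,c)=0$ for all $a,b,c\in F^{(n)}$) if and only if $\mathrm{wt}(f)\ge n$. Moreover, the images in $F^{(n)}$ of the regular words of weight less than $n$ are linearly independent (as a family indexed by these words) and span $F_3^{(n)}$; that is, they form a basis of the vector space $F_3^{(n)}$. -/

import Mathlib

noncomputable section

/-- The left-normed commutator `[a 0, a 1, …, a k]` (of degree `k + 1`) in an associative ring. -/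
def leftComm {A : Type*} [Ring A] (a : ℕ → A) : ℕ → A
  | 0 => a 0
  | k + 1 => leftComm a k * a (k + 1) - a (k + 1) * leftComm a k

/-- A T-ideal: a two-sided ideal stable under all endomorphisms of the (unital) algebra. -/
def IsTIdeal (K : Type*) {A : Type*} [Field K] [Ring A] [Algebra K A]
    (I : TwoSidedIdeal A) : Prop :=
  ∀ φ : A →ₐ[K] A, ∀ a ∈ I, φ a ∈ I

/-- The T-ideal generated by a set: the smallest T-ideal containing it. -/
def tIdealSpan (K : Type*) {A : Type*} [Field K] [Ring A] [Algebra K A]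
    (S : Set A) : TwoSidedIdeal A :=
  sInf {I | IsTIdeal K I ∧ S ⊆ I}

/-- `T^(n)`: the T-ideal of the free unital associative algebra `F` of countable rank generated
by the commutator `[x₁, …, xₙ]` of degree `n` in the free generators (used for `n ≥ 2`). -/
def lieNilpIdeal (K : Type*) [Field K] (n : ℕ) : TwoSidedIdeal (FreeAlgebra K ℕ) :=
  tIdealSpan K {leftComm (fun i => FreeAlgebra.ι K i) (n - 1)}

/-- `F^(n) = F / T^(n)`: the relatively free algebra with the identity `[x₁, …, xₙ] = 0`. -/
abbrev RelFree (K : Type*) [Field K] (n : ℕ) : Type _ :=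
  (lieNilpIdeal K n).ringCon.Quotient

/-- The image in `F^(n)` of the `i`-th free generator of `F`. -/
def relGen (K : Type*) [Field K] (n : ℕ) (i : ℕ) : RelFree K n :=
  (FreeAlgebra.ι K i : FreeAlgebra K ℕ)

/-- The subalgebra of rank three of `F^(n)`, generated by the first three generators. -/
def relFreeThree (K : Type*) [Field K] (n : ℕ) : Subalgebra K (RelFree K n) :=
  Algebra.adjoin K (Set.range fun i : Fin 3 => relGen K n i)

/-- The canonical homomorphism from the free algebra of rank three to `F^(n)`. -/
def toRelFree (K : Type*) [Field K] (n : ℕ) : FreeAlgebra K (Fin 3) →ₐ[K] RelFree K n :=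
  FreeAlgebra.lift K fun i => relGen K n i

/-- The polynomial `f` in three variables is an identity of the algebra `A`. -/
def IsIdentity {K : Type*} [Field K] (f : FreeAlgebra K (Fin 3))
    (A : Type*) [Ring A] [Algebra K A] : Prop :=
  ∀ a : Fin 3 → A, FreeAlgebra.lift K a f = 0

/-- Lie monomials in the free generators, with their degrees. -/
inductive IsLieMonomial (K : Type*) [Field K] {X : Type*} : ℕ → FreeLieAlgebra K X → Prop
  | of (x : X) : IsLieMonomial K 1 (FreeLieAlgebra.of K x)
  | lie {k l : ℕ} {u v : FreeLieAlgebra K X} (hu : IsLieMonomial K k u)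
      (hv : IsLieMonomial K l v) : IsLieMonomial K (k + l) ⁅u, v⁆

/-- The homogeneous component of degree `d` of the free Lie algebra. -/
def lieComponent (K : Type*) [Field K] (X : Type*) (d : ℕ) : Submodule K (FreeLieAlgebra K X) :=
  Submodule.span K {u | IsLieMonomial K d u}

section

attribute [local instance] LieRing.ofAssociativeRing

/-- The canonical map from the free Lie algebra to the free associative algebra on the same set,
the latter being a Lie algebra with respect to the commutator. -/
def lieToAssoc (K : Type*) [Field K] (X : Type*) : FreeLieAlgebra K X →ₗ[K] FreeAlgebra K X :=
  (FreeLieAlgebra.lift K (FreeAlgebra.ι K : X → FreeAlgebra K X) :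
    FreeLieAlgebra K X →ₗ⁅K⁆ FreeAlgebra K X)

end

/-- Index set of the regular words: finite nondecreasing sequences of indices
(the empty sequence is included; it gives the word `1`). -/
abbrev RegularIndex (ι : Type*) [LinearOrder ι] : Type _ :=
  {l : List ι // l.Pairwise (· ≤ ·)}

/-- The regular word `e i₁ * ⋯ * e iₜ`, `i₁ ≤ ⋯ ≤ iₜ`, with the product taken in the free
associative algebra. -/
def regularWord {K : Type*} [Field K] {X ι : Type*} [LinearOrder ι]
    (e : ι → FreeLieAlgebra K X) (w : RegularIndex ι) : FreeAlgebra K X :=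
  (w.1.map fun i => lieToAssoc K X (e i)).prod

/-- The weight `∑ deg iⱼ - t + 1` of a regular word of length `t`. The subtraction is not truncated
when all degrees are at least one, as the degrees of nonzero homogeneous Lie elements are. -/
def wordWeight {ι : Type*} [LinearOrder ι] (deg : ι → ℕ) (w : RegularIndex ι) : ℕ :=
  (w.1.map deg).sum + 1 - w.1.length

/-- The weight of an element with respect to a basis indexed by regular words: the least weight
of the words which occur in it with nonzero coefficient (`⊤` for the zero element). -/
def weight {K : Type*} [Field K] {A : Type*} [Ring A] [Algebra K A] {ι : Type*} [LinearOrder ι]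
    (deg : ι → ℕ) (B : Module.Basis (RegularIndex ι) K A) (f : A) : ℕ∞ :=
  (B.repr f).support.inf fun w => (wordWeight deg w : ℕ∞)

end

/-! Write C_i for `commIdeal A i`, generated by the left-normed commutators of i + 1 elements; this
shift makes indices additive. A T-ideal argument with a retraction of F onto F_3 shows that f is an
identity of F^(n) exactly when f lies in C_{n-1} of F_3. So the point is that C_{n-1} is the span of
the regular words of weight at least n. A Lie element of degree d counts d - 1, so weight minus one
is additive along a word.

High words lie in the ideal. With 3 invertible, C_i C_j ⊆ C_{i+j} for even i in any algebra
(`commIdeal.mul_mem_of_even`); the engine is [[C_i, A], A] ⊆ C_{i+2} (`commIdeal.lie_lie`). For i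
and j odd this fails in general, already for [x,y][z,t]. But for commutators in three generators the
product is skew-symmetric modulo C_{i+j} in four of its entries, and four entries taken from three
letters must repeat, so 2 invertible finishes (`IsGenComm.mul_mem_of_odd`).

The ideal contains nothing else. Over an infinite field the bracket of basis elements of degrees k,
l involves only basis elements of degree k + l, so a bracket raises the count by one. Hence words of
count at least p span a filtration containing C_p (`commIdeal_le_wordFilt`), and sorting a word only
costs shorter words of no smaller count (`wordFilt_le_span_sorted`). Linear independence of regular
words is the Poincaré–Birkhoff–Witt theorem, proved by the classical action on the symmetric
algebra. -/

/-! ### Commutator ideals and products with an even index -/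

section CommutatorIdeals

variable {A : Type*} [Ring A]

/-- `IsLeftComm i u`: `u` is a left-normed commutator of `i + 1` elements of `A`. -/
inductive IsLeftComm {A : Type*} [Ring A] : ℕ → A → Prop
  | base (a : A) : IsLeftComm 0 a
  | step {i : ℕ} {u : A} (hu : IsLeftComm i u) (a : A) : IsLeftComm (i + 1) ⁅u, a⁆

/-- The ideal generated by the left-normed commutators of `i + 1` elements. It is defined as a left
ideal; see `commIdeal.mul_right`. -/
def commIdeal (A : Type*) [Ring A] (i : ℕ) : Ideal A :=
  Ideal.span {u | IsLeftComm i u}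

theorem IsLeftComm.pred : ∀ {i : ℕ} {u : A}, IsLeftComm (i + 1) u → IsLeftComm i u
  | 0, u, _ => .base u
  | _ + 1, _, .step hu a => .step hu.pred a

theorem IsLeftComm.mem {i : ℕ} {u : A} (hu : IsLeftComm i u) : u ∈ commIdeal A i :=
  Ideal.subset_span hu

namespace commIdeal

theorem succ_le (i : ℕ) : commIdeal A (i + 1) ≤ commIdeal A i :=
  Ideal.span_mono fun _ hu => IsLeftComm.pred hu

theorem antitone : Antitone (commIdeal A) := antitone_nat_of_succ_le succ_le

theorem mem_zero (a : A) : a ∈ commIdeal A 0 := (IsLeftComm.base a).mem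

theorem mul_left {i : ℕ} {x : A} (a : A) (hx : x ∈ commIdeal A i) : a * x ∈ commIdeal A i :=
  Ideal.mul_mem_left _ a hx

/-- Moving a across a generator u costs ⁅u, a⁆, which lies in the next, smaller ideal. -/
theorem mul_right {i : ℕ} {x : A} (hx : x ∈ commIdeal A i) (a : A) : x * a ∈ commIdeal A i := by
  induction hx using Submodule.span_induction with
  | mem u hu =>
    have h : u * a = a * u + ⁅u, a⁆ := by rw [Ring.lie_def]; abel
    rw [h]
    exact add_mem (mul_left a (IsLeftComm.mem hu)) (succ_le i (IsLeftComm.step hu a).mem)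
  | zero => simp
  | add x y _ _ hx hy => rw [add_mul]; exact add_mem hx hy
  | smul c x _ hx => rw [smul_eq_mul, mul_assoc]; exact mul_left c hx

theorem of_isUnit_mul {i : ℕ} {c x : A} (hc : IsUnit c) (hx : c * x ∈ commIdeal A i) :
    x ∈ commIdeal A i := by
  obtain ⟨u, rfl⟩ := hc
  simpa using mul_left (↑u⁻¹ : A) hx

end commIdeal

open commIdeal

theorem IsLeftComm.lie_two {i : ℕ} {u : A} (hu : IsLeftComm i u) (a b : A) :
    ⁅u, ⁅a, b⁆⁆ ∈ commIdeal A (i + 2) := by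
  have h : ⁅u, ⁅a, b⁆⁆ = ⁅⁅u, a⁆, b⁆ - ⁅⁅u, b⁆, a⁆ := by
    simp only [Ring.lie_def]; noncomm_ring
  rw [h]
  exact sub_mem ((hu.step a).step b).mem ((hu.step b).step a).mem

theorem IsLeftComm.lie_three {i : ℕ} {u : A} (hu : IsLeftComm i u) (a b c : A) :
    ⁅u, ⁅⁅a, b⁆, c⁆⁆ ∈ commIdeal A (i + 3) := by
  have h : ⁅u, ⁅⁅a, b⁆, c⁆⁆ = ⁅⁅⁅u, a⁆, b⁆, c⁆ - ⁅⁅⁅u, b⁆, a⁆, c⁆ - ⁅⁅u, c⁆, ⁅a, b⁆⁆ := by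
    simp only [Ring.lie_def]; noncomm_ring
  rw [h]
  exact sub_mem (sub_mem (((hu.step a).step b).step c).mem (((hu.step b).step a).step c).mem)
    ((hu.step c).lie_two a b)

/-- Expand ⁅⁅u, b * c⁆, a⁆ by the Leibniz rule: up to reordering, the mixed terms are these two
products. -/
theorem IsLeftComm.mul_lie_skew {i : ℕ} {u : A} (hu : IsLeftComm i u) (a b c : A) :
    ⁅u, c⁆ * ⁅a, b⁆ + ⁅u, b⁆ * ⁅a, c⁆ ∈ commIdeal A (i + 2) := by
  have h : ⁅u, c⁆ * ⁅a, b⁆ + ⁅u, b⁆ * ⁅a, c⁆ =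
      b * ⁅⁅u, c⁆, a⁆ + ⁅⁅u, b⁆, a⁆ * c - ⁅⁅u, b * c⁆, a⁆ - ⁅⁅u, c⁆, ⁅b, a⁆⁆ := by
    simp only [Ring.lie_def]; noncomm_ring
  rw [h]
  exact sub_mem (sub_mem (add_mem (mul_left _ ((hu.step c).step a).mem)
    (mul_right ((hu.step b).step a).mem _)) ((hu.step _).step a).mem)
    (succ_le _ ((hu.step c).lie_two b a))

/-- Expand ⁅⁅⁅u, d * p⁆, q⁆, a⁆; apart from the two products wanted, the mixed terms pair up into
instances of `IsLeftComm.mul_lie_skew`. -/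
theorem IsLeftComm.mul_triple_exchange {i : ℕ} {u : A} (hu : IsLeftComm i u) (d p q a : A) :
    ⁅u, d⁆ * ⁅⁅p, q⁆, a⁆ + ⁅u, p⁆ * ⁅⁅d, q⁆, a⁆ ∈ commIdeal A (i + 3) := by
  have h : ⁅u, d⁆ * ⁅⁅p, q⁆, a⁆ + ⁅u, p⁆ * ⁅⁅d, q⁆, a⁆ =
      ⁅⁅⁅u, d * p⁆, q⁆, a⁆ - d * ⁅⁅⁅u, p⁆, q⁆, a⁆ - ⁅⁅⁅u, d⁆, q⁆, a⁆ * p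
      - (⁅⁅u, p⁆, a⁆ * ⁅d, q⁆ + ⁅⁅u, p⁆, q⁆ * ⁅d, a⁆)
      - (⁅⁅u, d⁆, a⁆ * ⁅p, q⁆ + ⁅⁅u, d⁆, q⁆ * ⁅p, a⁆)
      + ⁅⁅⁅u, p⁆, a⁆, ⁅d, q⁆⁆ + ⁅⁅⁅u, p⁆, q⁆, ⁅d, a⁆⁆ + ⁅⁅u, p⁆, ⁅⁅d, q⁆, a⁆⁆ := by
    simp only [Ring.lie_def]; noncomm_ring
  rw [h]
  refine add_mem (add_mem (add_mem (sub_mem (sub_mem (sub_mem (sub_mem ?_ ?_) ?_) ?_) ?_) ?_) ?_) ?_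
  · exact (((hu.step _).step _).step _).mem
  · exact mul_left _ (((hu.step _).step _).step _).mem
  · exact mul_right (((hu.step _).step _).step _).mem _
  · exact (hu.step p).mul_lie_skew d q a
  · exact (hu.step d).mul_lie_skew p q a
  · exact succ_le _ (((hu.step p).step a).lie_two d q)
  · exact succ_le _ (((hu.step p).step q).lie_two d a)
  · exact succ_le _ ((hu.step p).lie_three d q a)

/-- Modulo the ideal, ⁅u, d⁆ * ⁅⁅p, q⁆, a⁆ changes sign under transpositions of d, p, q, a. So the
three terms of the Jacobi identity in p, q, a are congruent, and three times the product vanishes.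
-/
theorem IsLeftComm.mul_triple (h3 : IsUnit (3 : A)) {i : ℕ} {u : A} (hu : IsLeftComm i u)
    (a b c : A) : u * ⁅⁅a, b⁆, c⁆ ∈ commIdeal A (i + 2) := by
  cases hu with
  | base => exact mul_left _ (((IsLeftComm.base a).step b).step c).mem
  | @step i u hu d =>
  set h : A → A → A → A → A := fun d p q a => ⁅u, d⁆ * ⁅⁅p, q⁆, a⁆ with hh
  have r1 (d p q a) : h d p q a + h d q p a = 0 := by
    simp only [hh, Ring.lie_def]; noncomm_ring
  have r2 (d p q a) : h d p q a + h p d q a ∈ commIdeal A (i + 3) :=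
    hu.mul_triple_exchange d p q a
  have r3 (d p q a) : h d p q a + h d q a p + h d a p q = 0 := by
    simp only [hh, Ring.lie_def]; noncomm_ring
  have r4 (d p q a) : h d p q a + h a p q d ∈ commIdeal A (i + 3) := by
    have e : h d p q a + h a p q d = (h d p q a + h d q a p + h d a p q)
        + (h a p q d + h a q d p + h a d p q) - (h d a p q + h a d p q)
        - ((h d q a p + h q d a p) - (h q d a p + h q a d p) + (h q a d p + h a q d p)) := by
      abel
    rw [e, r1 q d a p, r3, r3, add_zero, zero_sub, sub_zero]
    exact sub_mem (neg_mem (r2 _ _ _ _)) (add_mem (r2 _ _ _ _) (r2 _ _ _ _))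
  have r5 (d p q a) : h d p q a - h d q a p ∈ commIdeal A (i + 3) := by
    have e : h d p q a - h d q a p = (h d p q a + h a p q d) - (h a p q d + h p a q d)
        + (h p a q d + h p q a d) - (h p q a d + h d q a p) := by abel
    rw [e, r1]
    exact sub_mem (add_mem (sub_mem (r4 _ _ _ _) (r2 _ _ _ _)) (zero_mem _)) (r4 _ _ _ _)
  refine of_isUnit_mul h3 ?_
  have e : 3 * h d a b c = (h d a b c + h d b c a + h d c a b)
      + (h d a b c - h d b c a) + (h d a b c - h d b c a) + (h d b c a - h d c a b) := by
    noncomm_ring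
  change 3 * h d a b c ∈ _
  rw [e, r3]
  exact add_mem (add_mem (add_mem (zero_mem _) (r5 _ _ _ _)) (r5 _ _ _ _)) (r5 _ _ _ _)

/-- Meant for properties like ⁅⁅x, a⁆, b⁆ ∈ I, which are additive in x but not visibly stable under
left multiplication. -/
theorem commIdeal.induction {i : ℕ} {p : A → Prop} (h0 : p 0)
    (hadd : ∀ x y, p x → p y → p (x + y)) (hmul : ∀ c u, IsLeftComm i u → p (c * u))
    {x : A} (hx : x ∈ commIdeal A i) : p x := by
  have key : ∀ c : A, p (c * x) := by
    induction hx using Submodule.span_induction with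
    | mem u hu => exact fun c => hmul c u hu
    | zero => simpa using h0
    | add x y _ _ hx hy => intro c; rw [mul_add]; exact hadd _ _ (hx c) (hy c)
    | smul d x _ hx => intro c; rw [smul_eq_mul, ← mul_assoc]; exact hx _
  simpa using key 1

/-- In the Leibniz expansion for c * u the two mixed products form the skew sum of
`IsLeftComm.mul_lie_skew`, and u * ⁅⁅c, a⁆, b⁆ is `IsLeftComm.mul_triple`. A single bracket would
leave a mixed product unpaired. -/
theorem commIdeal.lie_lie (h3 : IsUnit (3 : A)) {i : ℕ} {x : A} (hx : x ∈ commIdeal A i)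
    (a b : A) : ⁅⁅x, a⁆, b⁆ ∈ commIdeal A (i + 2) := by
  refine commIdeal.induction (p := fun x => ⁅⁅x, a⁆, b⁆ ∈ commIdeal A (i + 2)) ?_ ?_ ?_ hx
  · simp [Ring.lie_def]
  · intro x y hx hy
    have h : ⁅⁅x + y, a⁆, b⁆ = ⁅⁅x, a⁆, b⁆ + ⁅⁅y, a⁆, b⁆ := by
      simp only [Ring.lie_def]; noncomm_ring
    rw [h]; exact add_mem hx hy
  · intro c u hu
    have h : ⁅⁅c * u, a⁆, b⁆ = c * ⁅⁅u, a⁆, b⁆ + (⁅u, b⁆ * ⁅c, a⁆ + ⁅u, a⁆ * ⁅c, b⁆)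
        + u * ⁅⁅c, a⁆, b⁆ - ⁅u, ⁅⁅c, a⁆, b⁆⁆ - ⁅⁅u, b⁆, ⁅c, a⁆⁆ - ⁅⁅u, a⁆, ⁅c, b⁆⁆ := by
      simp only [Ring.lie_def]; noncomm_ring
    rw [h]
    refine sub_mem (sub_mem (sub_mem (add_mem (add_mem ?_ ?_) ?_) ?_) ?_) ?_
    · exact mul_left _ ((hu.step a).step b).mem
    · exact hu.mul_lie_skew c a b
    · exact hu.mul_triple h3 c a b
    · exact succ_le _ (hu.lie_three c a b)
    · exact succ_le _ ((hu.step b).lie_two c a)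
    · exact succ_le _ ((hu.step a).lie_two c b)

/-- The iterated commutator `[x, a₁, …, aₖ]`. -/
def iterLie (x : A) (l : List A) : A := l.foldl (fun y a => ⁅y, a⁆) x

theorem iterLie_cons (x a : A) (l : List A) : iterLie x (a :: l) = iterLie ⁅x, a⁆ l := rfl

theorem iterLie_sub (x y : A) (l : List A) : iterLie (x - y) l = iterLie x l - iterLie y l := by
  induction l generalizing x y with
  | nil => rfl
  | cons a l ih =>
    have h : ⁅x - y, a⁆ = ⁅x, a⁆ - ⁅y, a⁆ := by simp only [Ring.lie_def]; noncomm_ring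
    rw [iterLie_cons, h, ih]; rfl

/-- By Jacobi, bracketing with w is a signed sum of iterated brackets with its j + 1 entries. The
tail t records the brackets still to be applied, as the induction requires. -/
theorem IsLeftComm.iterLie_lie_mem {I : Ideal A} {j : ℕ} {w : A} (hw : IsLeftComm j w) :
    ∀ (x : A) (t : List A),
      (∀ l : List A, l.length = j + 1 → iterLie x (l ++ t) ∈ I) → iterLie ⁅x, w⁆ t ∈ I := by
  induction hw with
  | base a => exact fun x t h => h [a] rfl
  | @step j w hw a ih =>
    intro x t h
    have e : ⁅x, ⁅w, a⁆⁆ = ⁅⁅x, w⁆, a⁆ - ⁅⁅x, a⁆, w⁆ := by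
      simp only [Ring.lie_def]; noncomm_ring
    rw [e, iterLie_sub]
    refine sub_mem ?_ ?_
    · refine ih x (a :: t) fun l hl => ?_
      simpa using h (l ++ [a]) (by simp [hl])
    · refine ih _ t fun l hl => ?_
      exact h (a :: l) (by simp [hl])

theorem commIdeal.iterLie_even (h3 : IsUnit (3 : A)) {k : ℕ} : ∀ {i : ℕ} {x : A} (l : List A),
    l.length = 2 * k → x ∈ commIdeal A i → iterLie x l ∈ commIdeal A (i + 2 * k) := by
  induction k with
  | zero => intro i x l hl hx; rw [List.length_eq_zero_iff.mp hl]; exact hx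
  | succ k ih =>
    intro i x l hl hx
    match l, hl with
    | a :: b :: l, hl =>
      have := ih l (by simpa [mul_add] using hl) (lie_lie h3 hx a b)
      rwa [show i + 2 * (k + 1) = i + 2 + 2 * k by ring]

/-- The j + 1 brackets are taken in pairs by `commIdeal.lie_lie`; `h` absorbs the odd one out. -/
theorem commIdeal.lie_mem_of_lie_one (h3 : IsUnit (3 : A)) {i : ℕ}
    (h : ∀ x ∈ commIdeal A i, ∀ a, ⁅x, a⁆ ∈ commIdeal A (i + 1))
    {x w : A} {j : ℕ} (hx : x ∈ commIdeal A i) (hw : IsLeftComm j w) :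
    ⁅x, w⁆ ∈ commIdeal A (i + j + 1) := by
  refine hw.iterLie_lie_mem x [] fun l hl => ?_
  rw [List.append_nil]
  obtain ⟨k, hk | hk⟩ := Nat.even_or_odd' l.length
  · rw [show i + j + 1 = i + 2 * k by omega]
    exact iterLie_even h3 l hk hx
  · match l, hl, hk with
    | a :: l, hl, hk =>
      rw [List.length_cons] at hl hk
      rw [show i + j + 1 = i + 1 + 2 * k by omega]
      exact iterLie_even h3 l (by omega) (h x hx a)

theorem commIdeal.mul_mem_of_gen {i j k : ℕ}
    (h : ∀ x ∈ commIdeal A i, ∀ w, IsLeftComm j w → x * w ∈ commIdeal A k)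
    {x y : A} (hx : x ∈ commIdeal A i) (hy : y ∈ commIdeal A j) : x * y ∈ commIdeal A k := by
  induction hy using Submodule.span_induction generalizing x with
  | mem w hw => exact h x hx w hw
  | zero => simp
  | add y z _ _ hy hz => rw [mul_add]; exact add_mem (hy hx) (hz hx)
  | smul c y _ hy => rw [smul_eq_mul, ← mul_assoc]; exact hy (mul_right hx c)

/-- The two claims feed each other: the bracket claim at r + 1 uses the product claim at r, and the
product claim follows from the bracket claim at the same level through x * ⁅w, b⁆ = ⁅x, w⁆ * b - ⁅x
* b, w⁆. -/
theorem commIdeal.even_properties (h3 : IsUnit (3 : A)) (r : ℕ) :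
    (∀ x ∈ commIdeal A (2 * r), ∀ a, ⁅x, a⁆ ∈ commIdeal A (2 * r + 1)) ∧
    ∀ (j : ℕ) (x y : A), x ∈ commIdeal A (2 * r) → y ∈ commIdeal A j →
      x * y ∈ commIdeal A (2 * r + j) := by
  induction r with
  | zero =>
    refine ⟨fun x _ a => ((IsLeftComm.base x).step a).mem, fun j x y _ hy => ?_⟩
    rw [show 2 * 0 + j = j by omega]
    exact mul_left x hy
  | succ r ih =>
    have g1 : ∀ u, IsLeftComm (2 * (r + 1)) u → ∀ c d : A,
        u * ⁅c, d⁆ ∈ commIdeal A (2 * r + 3) := by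
      intro u hu c d
      obtain ⟨u, hu', a, b, rfl⟩ : ∃ v, IsLeftComm (2 * r) v ∧ ∃ a b : A, u = ⁅⁅v, a⁆, b⁆ := by
        obtain _ | ⟨hu, b⟩ := hu
        obtain _ | ⟨hu, a⟩ := hu
        exact ⟨_, hu, a, b, rfl⟩
      have h : ⁅⁅u, a⁆, b⁆ * ⁅c, d⁆ = ⁅⁅u * ⁅c, d⁆, a⁆, b⁆ - ⁅u, a⁆ * ⁅⁅c, d⁆, b⁆
          - ⁅u, b⁆ * ⁅⁅c, d⁆, a⁆ - u * ⁅⁅⁅c, d⁆, a⁆, b⁆ := by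
        simp only [Ring.lie_def]; noncomm_ring
      rw [h]
      have hcd := (IsLeftComm.base c).step d
      refine sub_mem (sub_mem (sub_mem ?_ ?_) ?_) ?_
      · exact lie_lie h3 (ih.2 1 _ _ hu'.mem hcd.mem) a b
      · exact (hu'.step a).mul_triple h3 c d b
      · exact (hu'.step b).mul_triple h3 c d a
      · exact ih.2 3 _ _ hu'.mem ((hcd.step a).step b).mem
    have g2 : ∀ x ∈ commIdeal A (2 * (r + 1)), ∀ a, ⁅x, a⁆ ∈ commIdeal A (2 * (r + 1) + 1) := by
      intro x hx a
      refine commIdeal.induction (p := fun x => ⁅x, a⁆ ∈ commIdeal A (2 * (r + 1) + 1)) ?_ ?_ ?_ hx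
      · simp [Ring.lie_def]
      · intro x y hx hy
        have h : ⁅x + y, a⁆ = ⁅x, a⁆ + ⁅y, a⁆ := by simp only [Ring.lie_def]; noncomm_ring
        rw [h]; exact add_mem hx hy
      · intro c u hu
        have h : ⁅c * u, a⁆ = c * ⁅u, a⁆ + u * ⁅c, a⁆ - ⁅u, ⁅c, a⁆⁆ := by
          simp only [Ring.lie_def]; noncomm_ring
        rw [h]
        exact sub_mem (add_mem (mul_left c (hu.step a).mem) (g1 u hu c a))
          (succ_le _ (hu.lie_two c a))
    refine ⟨g2, fun j x y hx hy => mul_mem_of_gen ?_ hx hy⟩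
    intro x hx w hw
    cases hw with
    | base => exact mul_right hx _
    | @step j w hw b =>
      have h : x * ⁅w, b⁆ = ⁅x, w⁆ * b - ⁅x * b, w⁆ := by
        simp only [Ring.lie_def]; noncomm_ring
      rw [h, ← add_assoc]
      exact sub_mem (mul_right (lie_mem_of_lie_one h3 g2 hx hw) b)
        (lie_mem_of_lie_one h3 g2 (mul_right hx b) hw)

theorem commIdeal.mul_mem_of_even (h3 : IsUnit (3 : A)) {i j : ℕ} (hi : Even i) {x y : A}
    (hx : x ∈ commIdeal A i) (hy : y ∈ commIdeal A j) : x * y ∈ commIdeal A (i + j) := by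
  obtain ⟨r, rfl⟩ := hi
  rw [← two_mul] at hx ⊢
  exact (even_properties h3 r).2 j x y hx hy

end CommutatorIdeals

open commIdeal

/-! ### Products of odd-index commutators in three generators -/

section ThreeGenerators

variable {A : Type*} [Ring A]

/-- `IsGenComm g i u`: `u` is a left-normed commutator of `i + 1` elements of the family `g`. -/
inductive IsGenComm {A X : Type*} [Ring A] (g : X → A) : ℕ → A → Prop
  | base (a : X) : IsGenComm g 0 (g a)
  | step {i : ℕ} {u : A} (hu : IsGenComm g i u) (a : X) : IsGenComm g (i + 1) ⁅u, g a⁆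

theorem IsGenComm.isLeftComm {X : Type*} {g : X → A} {i : ℕ} {u : A} (hu : IsGenComm g i u) :
    IsLeftComm i u := by
  induction hu with
  | base a => exact .base _
  | step _ a ih => exact ih.step _

theorem commIdeal.mul_lie_skew_of_even (h3 : IsUnit (3 : A)) {p q : ℕ} (hp : Even p)
    {v w : A} (hv : IsLeftComm p v) (hw : IsLeftComm q w) (a b : A) :
    ⁅v, a⁆ * ⁅w, b⁆ + ⁅v, b⁆ * ⁅w, a⁆ ∈ commIdeal A (p + q + 2) := by
  have h : ⁅v, a⁆ * ⁅w, b⁆ + ⁅v, b⁆ * ⁅w, a⁆ =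
      ⁅⁅v * w, a⁆, b⁆ - ⁅⁅v, a⁆, b⁆ * w - v * ⁅⁅w, a⁆, b⁆ := by
    simp only [Ring.lie_def]; noncomm_ring
  rw [h]
  refine sub_mem (sub_mem ?_ ?_) ?_
  · exact lie_lie h3 (mul_mem_of_even h3 hp hv.mem hw.mem) a b
  · have := mul_mem_of_even h3 (hp.add even_two) ((hv.step a).step b).mem hw.mem
    rwa [add_right_comm] at this
  · rw [add_assoc]
    exact mul_mem_of_even h3 hp hv.mem ((hw.step a).step b).mem

/-- Two brackets move from the left factor to the right one at the cost of a sign: in the mixed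
terms the left index i + 1 is even, so they are harmless. -/
theorem commIdeal.lie_lie_mul_add (h3 : IsUnit (3 : A)) {i j : ℕ} (hi : Odd i)
    {u w : A} (hu : IsLeftComm i u) (hw : IsLeftComm j w) (huw : u * w ∈ commIdeal A (i + j))
    (a b : A) : ⁅⁅u, a⁆, b⁆ * w + u * ⁅⁅w, a⁆, b⁆ ∈ commIdeal A (i + j + 2) := by
  have h : ⁅⁅u, a⁆, b⁆ * w + u * ⁅⁅w, a⁆, b⁆ =
      ⁅⁅u * w, a⁆, b⁆ - ⁅u, a⁆ * ⁅w, b⁆ - ⁅u, b⁆ * ⁅w, a⁆ := by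
    simp only [Ring.lie_def]; noncomm_ring
  have e : i + j + 2 = i + 1 + (j + 1) := by ring
  rw [h]
  refine sub_mem (sub_mem (lie_lie h3 huw a b) ?_) ?_ <;> rw [e]
  · exact mul_mem_of_even h3 hi.add_one (hu.step a).mem (hw.step b).mem
  · exact mul_mem_of_even h3 hi.add_one (hu.step b).mem (hw.step a).mem

/-- A function of four variables with three values which is skew-symmetric modulo an ideal
vanishes modulo this ideal. -/
theorem mem_of_skew_four (h2 : IsUnit (2 : A)) {I : Ideal A}
    (h : Fin 3 → Fin 3 → Fin 3 → Fin 3 → A)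
    (s12 : ∀ a b c d, h a b c d + h b a c d ∈ I) (s23 : ∀ a b c d, h a b c d + h a c b d ∈ I)
    (s34 : ∀ a b c d, h a b c d + h a b d c ∈ I) (a b c d : Fin 3) : h a b c d ∈ I := by
  have half {x : A} (hx : x + x ∈ I) : x ∈ I := by
    obtain ⟨u, hu⟩ := h2
    have := I.mul_mem_left (↑u⁻¹) hx
    rwa [← two_mul, ← hu, Units.inv_mul_cancel_left] at this
  have tr {x y : A} (hxy : x + y ∈ I) (hy : y ∈ I) : x ∈ I := (I.add_mem_iff_left hy).mp hxy
  have d12 (a c d) : h a a c d ∈ I := half (s12 a a c d)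
  have d23 (a b d) : h a b b d ∈ I := half (s23 a b b d)
  have d34 (a b c) : h a b c c ∈ I := half (s34 a b c c)
  have d13 (a b d) : h a b a d ∈ I := tr (s12 a b a d) (d23 b a d)
  have d24 (a b c) : h a b c b ∈ I := tr (s34 a b c b) (d23 a b c)
  have d14 (a b c) : h a b c a ∈ I := tr (s12 a b c a) (d24 b a c)
  have key : a = b ∨ a = c ∨ a = d ∨ b = c ∨ b = d ∨ c = d := by omega
  rcases key with rfl | rfl | rfl | rfl | rfl | rfl
  exacts [d12 _ _ _, d13 _ _ _, d14 _ _ _, d23 _ _ _, d24 _ _ _, d34 _ _ _]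

/-- Moving brackets to the right in pairs reduces u to ⁅g d, g e⁆; then skew-symmetry in four
generators applies. -/
theorem IsGenComm.mul_mem_of_odd (h2 : IsUnit (2 : A)) (h3 : IsUnit (3 : A)) {g : Fin 3 → A}
    (n : ℕ) : ∀ (r j : ℕ) (u w : A), 2 * r + 1 + j = n → Odd j → IsGenComm g (2 * r + 1) u →
      IsGenComm g j w → u * w ∈ commIdeal A n := by
  induction n using Nat.strong_induction_on with
  | _ n ih =>
  intro r
  induction r with
  | zero =>
    intro j u w hn hj hu hw
    obtain _ | ⟨_ | _, e⟩ := hu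
    rename_i d
    match j, hj, hw with
    | 1, _, .step (.base f) a =>
      obtain rfl : 2 = n := by omega
      refine mem_of_skew_four h2 (fun d e a f => ⁅g d, g e⁆ * ⁅g f, g a⁆) ?_ ?_ ?_ d e a f
      · intro d e a f
        have : ⁅g d, g e⁆ * ⁅g f, g a⁆ + ⁅g e, g d⁆ * ⁅g f, g a⁆ = 0 := by
          simp only [Ring.lie_def]; noncomm_ring
        simp only [this, zero_mem]
      · intro d e a f
        exact mul_lie_skew_of_even h3 (by decide) (.base _) (.base _) _ _
      · intro d e a f
        have : ⁅g d, g e⁆ * ⁅g f, g a⁆ + ⁅g d, g e⁆ * ⁅g a, g f⁆ = 0 := by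
          simp only [Ring.lie_def]; noncomm_ring
        simp only [this, zero_mem]
    | 2, hj, _ => exact absurd hj (by decide)
    -- The four skew entries are d, e and the letters a, b of w; the letter c between them and the
    -- inner commutator v stay fixed.
    | j + 3, hj, .step (.step (.step (u := v) hv b) c) a =>
      have hj' : Even j := by
        obtain ⟨k, hk⟩ := hj; exact ⟨k - 1, by omega⟩
      obtain rfl : j + 4 = n := by omega
      refine mem_of_skew_four h2
        (fun d e a b => ⁅g d, g e⁆ * ⁅⁅⁅v, g b⁆, g c⁆, g a⁆) ?_ ?_ ?_ d e a b
      · intro d e a b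
        have : ⁅g d, g e⁆ * ⁅⁅⁅v, g b⁆, g c⁆, g a⁆ + ⁅g e, g d⁆ * ⁅⁅⁅v, g b⁆, g c⁆, g a⁆ = 0 := by
          rw [← add_mul, Ring.lie_def, Ring.lie_def (g e)]; simp
        simp only [this, zero_mem]
      · intro d e a b
        have := mul_lie_skew_of_even h3 (p := 0) (q := j + 2) (by decide)
          (.base (g d)) ((hv.isLeftComm.step (g b)).step (g c)) (g e) (g a)
        rwa [show 0 + (j + 2) + 2 = j + 4 by ring] at this
      -- To exchange a and b, shift the brackets with c and a onto ⁅g d, g e⁆. The new left factor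
      -- extends a commutator of even index 2, so a and b are skew there.
      · intro d e a b
        have t (a b) : ⁅⁅⁅g d, g e⁆, g c⁆, g a⁆ * ⁅v, g b⁆ + ⁅g d, g e⁆ * ⁅⁅⁅v, g b⁆, g c⁆, g a⁆ ∈
            commIdeal A (j + 4) := by
          have hw := hv.step b
          have hu := (IsGenComm.base (g := g) d).step e
          have := ih (j + 2) (by omega) 0 (j + 1) _ _ (by omega) hj'.add_one hu hw
          have := lie_lie_mul_add h3 odd_one hu.isLeftComm hw.isLeftComm
            (by rwa [show 1 + (j + 1) = j + 2 by ring]) (g c) (g a)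
          rwa [show 1 + (j + 1) + 2 = j + 4 by ring] at this
        have s := mul_lie_skew_of_even h3 (p := 2) (by decide)
          (((IsLeftComm.base (g d)).step (g e)).step (g c)) hv.isLeftComm (g a) (g b)
        rw [show 2 + j + 2 = j + 4 by ring] at s
        have := sub_mem (add_mem (t a b) (t b a)) s
        convert this using 1
        abel
  | succ r ihr =>
    intro j u w hn hj hu hw
    obtain _ | ⟨_ | ⟨hu, a⟩, b⟩ := hu
    rename_i u
    have h1 := ih (2 * r + 1 + j) (by omega) r j u w rfl hj hu hw
    have h2 := lie_lie_mul_add h3 (odd_two_mul_add_one r) hu.isLeftComm hw.isLeftComm h1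
      (g a) (g b)
    have h4 := ihr (j + 2) u _ (by omega) (hj.add_even (by decide)) hu ((hw.step a).step b)
    rw [show 2 * r + 1 + j + 2 = n by omega] at h2
    exact ((commIdeal A n).add_mem_iff_left h4).mp h2

end ThreeGenerators

/-! ### Products of homogeneous Lie elements -/

section GenSpan

variable (K : Type*) {A X : Type*} [Field K] [Ring A] [Algebra K A]

/-- The span of the left-normed commutators of `i + 1` elements of the family `g`. -/
def genCommSpan (g : X → A) (i : ℕ) : Submodule K A := Submodule.span K {u | IsGenComm g i u}

variable {K}

theorem lie_mem_genCommSpan_of_isGenComm {g : X → A} {i j : ℕ} {u w : A}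
    (hu : u ∈ genCommSpan K g i) (hw : IsGenComm g j w) :
    ⁅u, w⁆ ∈ genCommSpan K g (i + j + 1) := by
  have h1 {i : ℕ} {u : A} (hu : u ∈ genCommSpan K g i) (a : X) :
      ⁅u, g a⁆ ∈ genCommSpan K g (i + 1) := by
    induction hu using Submodule.span_induction with
    | mem u hu => exact Submodule.subset_span (IsGenComm.step hu a)
    | zero => simp [Ring.lie_def]
    | add x y _ _ hx hy =>
      have h : ⁅x + y, g a⁆ = ⁅x, g a⁆ + ⁅y, g a⁆ := by simp only [Ring.lie_def]; noncomm_ring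
      rw [h]; exact add_mem hx hy
    | smul c x _ hx =>
      have h : ⁅c • x, g a⁆ = c • ⁅x, g a⁆ := by simp [Ring.lie_def, smul_sub]
      rw [h]; exact Submodule.smul_mem _ c hx
  induction hw generalizing i u with
  | base a => exact h1 hu a
  | @step j w hw a ih =>
    have e : ⁅u, ⁅w, g a⁆⁆ = ⁅⁅u, w⁆, g a⁆ - ⁅⁅u, g a⁆, w⁆ := by
      simp only [Ring.lie_def]; noncomm_ring
    rw [e]
    refine sub_mem (h1 (ih hu) a) ?_
    have := ih (h1 hu a)
    rwa [show i + 1 + j + 1 = i + (j + 1) + 1 by ring] at this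

theorem lie_mem_genCommSpan {g : X → A} {i j : ℕ} {u w : A} (hu : u ∈ genCommSpan K g i)
    (hw : w ∈ genCommSpan K g j) : ⁅u, w⁆ ∈ genCommSpan K g (i + j + 1) := by
  induction hw using Submodule.span_induction with
  | mem w hw => exact lie_mem_genCommSpan_of_isGenComm hu hw
  | zero => simp [Ring.lie_def]
  | add x y _ _ hx hy =>
    have h : ⁅u, x + y⁆ = ⁅u, x⁆ + ⁅u, y⁆ := by simp only [Ring.lie_def]; noncomm_ring
    rw [h]; exact add_mem hx hy
  | smul c x _ hx =>
    have h : ⁅u, c • x⁆ = c • ⁅u, x⁆ := by simp [Ring.lie_def, smul_sub]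
    rw [h]; exact Submodule.smul_mem _ c hx

theorem commIdeal.smul_mem (c : K) {i : ℕ} {x : A} (hx : x ∈ commIdeal A i) :
    c • x ∈ commIdeal A i := by
  rw [Algebra.smul_def]; exact mul_left _ hx

theorem mem_commIdeal_of_mem_genCommSpan {g : X → A} {i : ℕ} {u : A}
    (hu : u ∈ genCommSpan K g i) : u ∈ commIdeal A i := by
  induction hu using Submodule.span_induction with
  | mem w hw => exact (IsGenComm.isLeftComm hw).mem
  | zero => exact zero_mem _
  | add x y _ _ hx hy => exact add_mem hx hy
  | smul c x _ hx => exact smul_mem c hx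

theorem mul_mem_commIdeal_of_odd (h2 : IsUnit (2 : A)) (h3 : IsUnit (3 : A)) {g : Fin 3 → A}
    {i j : ℕ} (hi : Odd i) (hj : Odd j) {u w : A} (hu : u ∈ genCommSpan K g i)
    (hw : w ∈ genCommSpan K g j) : u * w ∈ commIdeal A (i + j) := by
  obtain ⟨r, rfl⟩ := hi
  induction hu, hw using Submodule.span_induction₂ with
  | mem_mem u w hu hw => exact IsGenComm.mul_mem_of_odd h2 h3 _ r j u w rfl hj hu hw
  | zero_left => simp
  | zero_right => simp
  | add_left x y z _ _ _ hx hy => rw [add_mul]; exact add_mem hx hy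
  | add_right x y z _ _ _ hx hy => rw [mul_add]; exact add_mem hx hy
  | smul_left c x y _ _ h => rw [smul_mul_assoc]; exact smul_mem c h
  | smul_right c x y _ _ h => rw [mul_smul_comm]; exact smul_mem c h

/-- An even-index first factor splits off. An odd one is paired with an odd successor, or exchanged
with an even successor; the correction ⁅u, w⁆ shortens the word and has index one larger than
needed. -/
theorem list_prod_mem_commIdeal (h2 : IsUnit (2 : A)) (h3 : IsUnit (3 : A)) {g : Fin 3 → A}
    (n : ℕ) : ∀ l : List (ℕ × A), l.length = n → (∀ p ∈ l, p.2 ∈ genCommSpan K g p.1) →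
      (l.map Prod.snd).prod ∈ commIdeal A (l.map Prod.fst).sum := by
  induction n using Nat.strong_induction_on with
  | _ n ih =>
  rintro (_ | ⟨⟨i, u⟩, l⟩) hn hl
  · exact mem_zero _
  subst hn
  simp only [List.mem_cons, forall_eq_or_imp] at hl
  obtain ⟨hu, hl⟩ := hl
  obtain hi | hi := Nat.even_or_odd i
  · simpa using mul_mem_of_even h3 hi (mem_commIdeal_of_mem_genCommSpan hu)
      (ih l.length (by simp) l rfl hl)
  obtain _ | ⟨⟨j, w⟩, l⟩ := l
  · simpa using mem_commIdeal_of_mem_genCommSpan hu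
  simp only [List.mem_cons, forall_eq_or_imp] at hl
  obtain ⟨hw, hl⟩ := hl
  simp only [List.map_cons, List.prod_cons, List.sum_cons]
  obtain hj | hj := Nat.even_or_odd j
  · have h1 := mul_mem_of_even h3 hj (mem_commIdeal_of_mem_genCommSpan hw)
      (ih (l.length + 1) (by simp) ((i, u) :: l) rfl
        (by simpa only [List.mem_cons, forall_eq_or_imp] using ⟨hu, hl⟩))
    have h2 := succ_le _ (ih (l.length + 1) (by simp) ((i + j + 1, ⁅u, w⁆) :: l) rfl
        (by simpa only [List.mem_cons, forall_eq_or_imp] using ⟨lie_mem_genCommSpan hu hw, hl⟩)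
        |> (by simpa [add_right_comm _ 1] using ·))
    simp only [List.map_cons, List.prod_cons, List.sum_cons] at h1 h2
    have e : u * (w * (l.map Prod.snd).prod) =
        w * (u * (l.map Prod.snd).prod) + ⁅u, w⁆ * (l.map Prod.snd).prod := by
      simp only [Ring.lie_def]; noncomm_ring
    rw [e]
    refine add_mem ?_ ?_
    · rwa [add_left_comm]
    · rwa [← add_assoc]
  · rw [← mul_assoc, ← add_assoc]
    exact mul_mem_of_even h3 (hi.add_odd hj) (mul_mem_commIdeal_of_odd h2 h3 hi hj hu hw)
      (ih l.length (by simp) l rfl hl)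

end GenSpan

/-! ### The Poincaré–Birkhoff–Witt representation -/

section PBW

variable {K L ι : Type*} [Field K] [LieRing L] [LieAlgebra K L]

/-- The underlying space of the Poincaré–Birkhoff–Witt representation: the symmetric algebra of
`L` with its basis of monomials in the elements of a basis of `L`. -/
abbrev PBWSpace (K ι : Type*) [Field K] : Type _ := Multiset ι →₀ K

/-- The span of the monomials of degree at most `n`. -/
def pbwFilt (K ι : Type*) [Field K] (n : ℕ) : Submodule K (PBWSpace K ι) :=
  Finsupp.supported K K {M | M.card ≤ n}

theorem single_mem_pbwFilt {n : ℕ} {M : Multiset ι} (h : M.card ≤ n) :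
    (Finsupp.single M 1 : PBWSpace K ι) ∈ pbwFilt K ι n :=
  Finsupp.single_mem_supported K 1 h

theorem pbwFilt_mono {m n : ℕ} (h : m ≤ n) : pbwFilt K ι m ≤ pbwFilt K ι n :=
  Finsupp.supported_mono fun _ hM => le_trans hM h

theorem linearCombination_mem_of_pbwFilt {V : Type*} [AddCommGroup V] [Module K V]
    {f : Multiset ι → V} {n : ℕ} {S : Submodule K V} (hf : ∀ M, M.card ≤ n → f M ∈ S)
    {x : PBWSpace K ι} (hx : x ∈ pbwFilt K ι n) : Finsupp.linearCombination K f x ∈ S := by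
  rw [Finsupp.linearCombination_apply]
  exact S.sum_mem fun M hM => S.smul_mem _ (hf M (hx hM))

variable [LinearOrder ι]

/-- The action of `e i` on the monomial `M`, computed by recursion on a bound for the degree
of `M`. -/
noncomputable def pbwActAux (e : Module.Basis ι K L) : ℕ → ι → Multiset ι → PBWSpace K ι
  | 0, i, M => Finsupp.single (i ::ₘ M) 1
  | n + 1, i, M =>
    match M.sort (· ≤ ·) with
    | [] => Finsupp.single (i ::ₘ M) 1
    | j :: l =>
      -- For j < i the value is forced by e_i e_j l = e_j e_i l + [e_i, e_j] l. The leading part i·l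
      -- of e_i l is sent by e_j to the monomial i·M, and only the lower remainder needs recursion.
      if i ≤ j then Finsupp.single (i ::ₘ M) 1
      else Finsupp.single (i ::ₘ M) 1
        + Finsupp.linearCombination K (pbwActAux e n j)
            (pbwActAux e n i (l : Multiset ι) - Finsupp.single (i ::ₘ (l : Multiset ι)) 1)
        + (e.repr ⁅e i, e j⁆).sum fun k c => c • pbwActAux e n k (l : Multiset ι)

theorem pbwActAux_sub_mem (e : Module.Basis ι K L) (n : ℕ) : ∀ (i : ι) (M : Multiset ι),
    M.card ≤ n → pbwActAux e n i M - Finsupp.single (i ::ₘ M) 1 ∈ pbwFilt K ι M.card := by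
  induction n with
  | zero => intro i M _; simp [pbwActAux]
  | succ n ih =>
    intro i M hM
    have mem (i : ι) (M : Multiset ι) (hM : M.card ≤ n) :
        pbwActAux e n i M ∈ pbwFilt K ι (M.card + 1) := by
      rw [← sub_add_cancel (pbwActAux e n i M) (Finsupp.single (i ::ₘ M) 1)]
      exact add_mem (pbwFilt_mono (Nat.le_succ _) (ih i M hM)) (single_mem_pbwFilt (by simp))
    have hsort := M.sort_eq (· ≤ ·)
    rw [pbwActAux]
    split
    · simp
    · rename_i j l hl
      rw [hl] at hsort
      have hc : M.card = l.length + 1 := by rw [← hsort]; simp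
      split
      · simp
      · rw [add_assoc, add_sub_cancel_left]
        refine add_mem ?_ ?_
        · refine linearCombination_mem_of_pbwFilt (n := l.length) (fun N hN => ?_) ?_
          · exact pbwFilt_mono (by omega) (mem j N (by omega))
          · simpa using ih i (l : Multiset ι) (by simp; omega)
        · refine Submodule.sum_mem _ fun k _ => Submodule.smul_mem _ _ ?_
          exact pbwFilt_mono (by simp [hc]) (mem k (l : Multiset ι) (by simp; omega))

/-- The recursion bound is irrelevant once it reaches the degree of M. -/
theorem pbwActAux_eq (e : Module.Basis ι K L) (m : ℕ) : ∀ (n : ℕ) (i : ι) (M : Multiset ι),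
    M.card ≤ m → M.card ≤ n → pbwActAux e m i M = pbwActAux e n i M := by
  have zero (n : ℕ) (i : ι) : pbwActAux e n i 0 = Finsupp.single (i ::ₘ 0) 1 := by
    cases n <;> simp [pbwActAux]
  induction m with
  | zero =>
    intro n i M hM _
    obtain rfl : M = 0 := by simpa using hM
    rw [zero, zero]
  | succ m ih =>
    rintro (_ | n) i M hM hn
    · obtain rfl : M = 0 := by simpa using hn
      rw [zero, zero]
    · have hsort := M.sort_eq (· ≤ ·)
      rw [pbwActAux, pbwActAux]
      generalize M.sort (· ≤ ·) = s at hsort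
      match s, hsort with
      | [], _ => rfl
      | j :: l, hsort =>
        have hc : M.card = l.length + 1 := by rw [← hsort]; simp
        have hl (k : ι) : pbwActAux e m k (l : Multiset ι) = pbwActAux e n k (l : Multiset ι) :=
          ih n k _ (by simp; omega) (by simp; omega)
        have hmem := pbwActAux_sub_mem e n i (l : Multiset ι) (by simp; omega)
        simp only [hl]
        split
        · rfl
        · congr 2
          rw [Finsupp.linearCombination_apply, Finsupp.linearCombination_apply]
          refine Finsupp.sum_congr fun N hN => ?_
          have hN' : N.card ≤ l.length := by simpa using hmem hN
          rw [ih n j N (by omega) (by omega)]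

/-- The action of a basis element on the monomial `M`. -/
noncomputable def pbwAct (e : Module.Basis ι K L) (i : ι) (M : Multiset ι) : PBWSpace K ι :=
  pbwActAux e M.card i M

/-- The Poincaré–Birkhoff–Witt representation of `L`, as a linear map. -/
noncomputable def pbwLin (e : Module.Basis ι K L) : L →ₗ[K] Module.End K (PBWSpace K ι) :=
  e.constr K fun i => Finsupp.linearCombination K (pbwAct e i)

theorem pbwLin_basis_single (e : Module.Basis ι K L) (i : ι) (M : Multiset ι) :
    pbwLin e (e i) (Finsupp.single M 1) = pbwAct e i M := by
  simp [pbwLin]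

theorem pbwLin_of_le (e : Module.Basis ι K L) {i : ι} {M : Multiset ι} (h : ∀ j ∈ M, i ≤ j) :
    pbwLin e (e i) (Finsupp.single M 1) = Finsupp.single (i ::ₘ M) 1 := by
  rw [pbwLin_basis_single, pbwAct]
  have hsort := M.sort_eq (· ≤ ·)
  cases hc : M.card with
  | zero => rfl
  | succ n =>
    rw [pbwActAux]
    split
    · rfl
    · rename_i j l hl
      rw [hl] at hsort
      rw [if_pos (h j (by rw [← hsort]; simp))]

theorem pbwLin_sub_mem (e : Module.Basis ι K L) (i : ι) (M : Multiset ι) :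
    pbwLin e (e i) (Finsupp.single M 1) - Finsupp.single (i ::ₘ M) 1 ∈ pbwFilt K ι M.card := by
  rw [pbwLin_basis_single]
  exact pbwActAux_sub_mem e _ i M le_rfl

/-- Here j heads the sorted form of j·M, so the relation is the recursive definition itself. -/
theorem pbwLin_comm_of_le (e : Module.Basis ι K L) {i j : ι} (hij : j < i) {M : Multiset ι}
    (h : ∀ k ∈ M, j ≤ k) :
    pbwLin e (e i) (pbwLin e (e j) (Finsupp.single M 1)) =
      pbwLin e (e j) (pbwLin e (e i) (Finsupp.single M 1))
        + pbwLin e ⁅e i, e j⁆ (Finsupp.single M 1) := by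
  have hs : (j ::ₘ M).sort (· ≤ ·) = j :: M.sort (· ≤ ·) := Multiset.sort_cons _ _ _ h
  have hM : ((M.sort (· ≤ ·) : List ι) : Multiset ι) = M := M.sort_eq _
  have hmem := pbwActAux_sub_mem e M.card i M le_rfl
  have h1 : Finsupp.linearCombination K (pbwActAux e M.card j)
      (pbwActAux e M.card i M - Finsupp.single (i ::ₘ M) 1) =
      pbwLin e (e j) (pbwAct e i M - Finsupp.single (i ::ₘ M) 1) := by
    rw [pbwLin, e.constr_basis, Finsupp.linearCombination_apply, Finsupp.linearCombination_apply,
      pbwAct]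
    refine Finsupp.sum_congr fun N hN => ?_
    rw [pbwAct, pbwActAux_eq e _ N.card j N (hmem hN) le_rfl]
  have h2 : ((e.repr ⁅e i, e j⁆).sum fun k c => c • pbwActAux e M.card k M) =
      pbwLin e ⁅e i, e j⁆ (Finsupp.single M 1) := by
    rw [pbwLin, e.constr_apply, Finsupp.sum, Finsupp.sum, LinearMap.sum_apply]
    simp [pbwAct]
  have h3 : pbwLin e (e j) (Finsupp.single (i ::ₘ M) 1) = Finsupp.single (j ::ₘ i ::ₘ M) 1 :=
    pbwLin_of_le e (by simpa using ⟨hij.le, h⟩)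
  rw [pbwLin_of_le e h, pbwLin_basis_single e i (j ::ₘ M), pbwAct, Multiset.card_cons, pbwActAux,
    hs]
  simp only [not_le.mpr hij, if_false]
  rw [hM, h1, h2, map_sub, h3, Multiset.cons_swap, pbwLin_basis_single e i M]
  abel

/-- Induction on the degree of M. If j is not minimal, write M = e_k N with k smallest, move e_k to
the left on both sides, and compare by the Jacobi identity. -/
theorem pbwLin_lie_single (e : Module.Basis ι K L) (n : ℕ) : ∀ (M : Multiset ι), M.card ≤ n →
    ∀ u v : L, pbwLin e u (pbwLin e v (Finsupp.single M 1)) =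
      pbwLin e v (pbwLin e u (Finsupp.single M 1)) + pbwLin e ⁅u, v⁆ (Finsupp.single M 1) := by
  induction n using Nat.strong_induction_on with
  | _ n ih =>
  intro M hM
  have basis : ∀ i j, j < i → pbwLin e (e i) (pbwLin e (e j) (Finsupp.single M 1)) =
      pbwLin e (e j) (pbwLin e (e i) (Finsupp.single M 1))
        + pbwLin e ⁅e i, e j⁆ (Finsupp.single M 1) := by
    intro i j hij
    by_cases hj : ∀ k ∈ M, j ≤ k
    · exact pbwLin_comm_of_le e hij hj
    obtain ⟨k, N, rfl, hN⟩ : ∃ k N, M = k ::ₘ N ∧ ∀ m ∈ N, k ≤ m := by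
      have hsort := M.sort_eq (· ≤ ·)
      have hp := M.pairwise_sort (· ≤ ·)
      generalize M.sort (· ≤ ·) = s at hsort hp
      match s, hsort, hp with
      | [], hsort, _ => exact absurd (by simp [← hsort]) hj
      | k :: l, hsort, hp =>
        refine ⟨k, l, by rw [← hsort]; simp, ?_⟩
        simpa using (List.pairwise_cons.mp hp).1
    have hkj : k < j := by
      by_contra hk
      rw [not_lt] at hk
      exact hj (by simpa using ⟨hk, fun m hm => hk.trans (hN m hm)⟩)
    have hcard : N.card < n := by simpa using hM
    have ihN := ih N.card hcard N le_rfl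
    have ihF : ∀ x ∈ pbwFilt K ι N.card, ∀ u v : L,
        pbwLin e u (pbwLin e v x) = pbwLin e v (pbwLin e u x) + pbwLin e ⁅u, v⁆ x := by
      intro x hx u v
      rw [pbwFilt, Finsupp.supported_eq_span_single] at hx
      induction hx using Submodule.span_induction with
      | mem x hx =>
        obtain ⟨P, hP, rfl⟩ := hx
        exact ih N.card hcard P hP u v
      | zero => simp
      | add x y _ _ hx hy => simp only [map_add, hx, hy]; abel
      | smul c x _ hx => simp only [map_smul, hx, smul_add]
    have hk : Finsupp.single (k ::ₘ N) 1 = pbwLin e (e k) (Finsupp.single N 1) :=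
      (pbwLin_of_le e hN).symm
    have three (a b : ι) (ha : k < a) (hb : k < b) :
        pbwLin e (e a) (pbwLin e (e k) (pbwLin e (e b) (Finsupp.single N 1))) =
          pbwLin e (e k) (pbwLin e (e a) (pbwLin e (e b) (Finsupp.single N 1)))
          + pbwLin e ⁅e a, e k⁆ (pbwLin e (e b) (Finsupp.single N 1)) := by
      -- The remainder of e_b N has degree at most that of N, so induction applies; on the leading
      -- monomial b·N the index k is minimal.
      rw [← sub_add_cancel (pbwLin e (e b) (Finsupp.single N 1)) (Finsupp.single (b ::ₘ N) 1)]
      simp only [map_add]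
      rw [ihF _ (pbwLin_sub_mem e b N), pbwLin_comm_of_le e ha (M := b ::ₘ N)
        (by simpa using ⟨hb.le, hN⟩)]
      abel
    have swap (a b : ι) (ha : k < a) (hb : k < b) :
        pbwLin e (e a) (pbwLin e (e b) (Finsupp.single (k ::ₘ N) 1)) =
          pbwLin e (e k) (pbwLin e (e a) (pbwLin e (e b) (Finsupp.single N 1)))
          + pbwLin e ⁅e a, e k⁆ (pbwLin e (e b) (Finsupp.single N 1))
          + pbwLin e ⁅e b, e k⁆ (pbwLin e (e a) (Finsupp.single N 1))
          + pbwLin e ⁅e a, ⁅e b, e k⁆⁆ (Finsupp.single N 1) := by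
      rw [hk, ihN (e b) (e k), map_add, three a b ha hb, ihN (e a) ⁅e b, e k⁆, add_assoc _ _
        (pbwLin e ⁅e a, ⁅e b, e k⁆⁆ _)]
    rw [swap i j (hkj.trans hij) hkj, swap j i hkj (hkj.trans hij), ihN (e i) (e j), map_add,
      hk, ihN ⁅e i, e j⁆ (e k)]
    have jac : ⁅e i, ⁅e j, e k⁆⁆ = ⁅⁅e i, e j⁆, e k⁆ + ⁅e j, ⁅e i, e k⁆⁆ := leibniz_lie _ _ _
    rw [jac, map_add, LinearMap.add_apply]
    abel
  have basis' : ∀ i j, pbwLin e (e i) (pbwLin e (e j) (Finsupp.single M 1)) =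
      pbwLin e (e j) (pbwLin e (e i) (Finsupp.single M 1))
        + pbwLin e ⁅e i, e j⁆ (Finsupp.single M 1) := by
    intro i j
    rcases lt_trichotomy i j with h | rfl | h
    · rw [basis j i h, ← lie_skew (e i) (e j), map_neg, LinearMap.neg_apply, add_assoc,
        add_neg_cancel, add_zero]
    · simp
    · exact basis i j h
  intro u v
  induction e.mem_span u using Submodule.span_induction with
  | zero => simp
  | add u u' _ _ hu hu' => simp only [map_add, LinearMap.add_apply, add_lie, hu, hu']; abel
  | smul c u _ hu => simp only [map_smul, LinearMap.smul_apply, smul_lie, hu, smul_add]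
  | mem u hu =>
    obtain ⟨i, rfl⟩ := hu
    induction e.mem_span v using Submodule.span_induction with
    | zero => simp
    | add u u' _ _ hu hu' => simp only [map_add, LinearMap.add_apply, lie_add, hu, hu']; abel
    | smul c u _ hu => simp only [map_smul, LinearMap.smul_apply, lie_smul, hu, smul_add]
    | mem v hv =>
      obtain ⟨j, rfl⟩ := hv
      exact basis' i j

theorem pbwLin_lie (e : Module.Basis ι K L) (u v : L) :
    pbwLin e ⁅u, v⁆ = pbwLin e u * pbwLin e v - pbwLin e v * pbwLin e u := by
  refine Finsupp.lhom_ext' fun M => LinearMap.ext_ring ?_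
  simp [pbwLin_lie_single e _ M le_rfl u v]

end PBW

/-! ### The weight filtration by words -/

section WordFiltration

variable {K A ι : Type*} [Field K] [Ring A] [Algebra K A]

/-- The span of the products of members of the family `E` of total weight at least `p`. -/
def wordFilt (K : Type*) [Field K] [Algebra K A] (E : ι → A) (wt : ι → ℕ) (p : ℕ) :
    Submodule K A :=
  Submodule.span K {x | ∃ l : List ι, p ≤ (l.map wt).sum ∧ x = (l.map E).prod}

variable {E : ι → A} {wt : ι → ℕ}

theorem prod_mem_wordFilt {p : ℕ} {l : List ι} (h : p ≤ (l.map wt).sum) :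
    (l.map E).prod ∈ wordFilt K E wt p :=
  Submodule.subset_span ⟨l, h, rfl⟩

theorem wordFilt_anti {p q : ℕ} (h : p ≤ q) : wordFilt K E wt q ≤ wordFilt K E wt p :=
  Submodule.span_mono fun _ ⟨l, hl, hx⟩ => ⟨l, h.trans hl, hx⟩

theorem basic_mem_wordFilt (i : ι) : E i ∈ wordFilt K E wt (wt i) := by
  simpa using prod_mem_wordFilt (K := K) (E := E) (wt := wt) (l := [i]) (by simp)

theorem mul_mem_wordFilt {p q : ℕ} {x y : A} (hx : x ∈ wordFilt K E wt p)
    (hy : y ∈ wordFilt K E wt q) : x * y ∈ wordFilt K E wt (p + q) := by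
  induction hx, hy using Submodule.span_induction₂ with
  | mem_mem x y hx hy =>
    obtain ⟨l, hl, rfl⟩ := hx
    obtain ⟨m, hm, rfl⟩ := hy
    rw [← List.prod_append, ← List.map_append]
    exact prod_mem_wordFilt (by simpa using add_le_add hl hm)
  | zero_left => simp
  | zero_right => simp
  | add_left x y z _ _ _ hx hy => rw [add_mul]; exact add_mem hx hy
  | add_right x y z _ _ _ hx hy => rw [mul_add]; exact add_mem hx hy
  | smul_left c x y _ _ h => rw [smul_mul_assoc]; exact Submodule.smul_mem _ c h
  | smul_right c x y _ _ h => rw [mul_smul_comm]; exact Submodule.smul_mem _ c h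

variable (hE : ∀ i j, ⁅E i, E j⁆ ∈ Submodule.span K {x | ∃ k, wt i + wt j + 1 ≤ wt k ∧ x = E k})

include hE in
theorem lie_mem_wordFilt {p q : ℕ} {x y : A} (hx : x ∈ wordFilt K E wt p)
    (hy : y ∈ wordFilt K E wt q) : ⁅x, y⁆ ∈ wordFilt K E wt (p + q + 1) := by
  have h1 (i j) : ⁅E i, E j⁆ ∈ wordFilt K E wt (wt i + wt j + 1) := by
    refine Submodule.span_le.mpr ?_ (hE i j)
    rintro _ ⟨k, hk, rfl⟩
    exact wordFilt_anti hk (basic_mem_wordFilt k)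
  have h2 (i) (m : List ι) : ⁅E i, (m.map E).prod⁆ ∈
      wordFilt K E wt (wt i + (m.map wt).sum + 1) := by
    induction m with
    | nil => simp [Ring.lie_def]
    | cons j m ih =>
      have e : ⁅E i, ((j :: m).map E).prod⁆ =
          ⁅E i, E j⁆ * (m.map E).prod + E j * ⁅E i, (m.map E).prod⁆ := by
        rw [List.map_cons, List.prod_cons]
        simp only [Ring.lie_def]; noncomm_ring
      rw [e, List.map_cons, List.sum_cons]
      refine add_mem ?_ ?_
      · have := mul_mem_wordFilt (h1 i j) (prod_mem_wordFilt (l := m) le_rfl)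
        rwa [show wt i + (wt j + (m.map wt).sum) + 1 = wt i + wt j + 1 + (m.map wt).sum by ring]
      · have := mul_mem_wordFilt (basic_mem_wordFilt (K := K) (E := E) (wt := wt) j) ih
        rwa [show wt i + (wt j + (m.map wt).sum) + 1 = wt j + (wt i + (m.map wt).sum + 1) by ring]
  have h3 (l m : List ι) : ⁅(l.map E).prod, (m.map E).prod⁆ ∈
      wordFilt K E wt ((l.map wt).sum + (m.map wt).sum + 1) := by
    induction l with
    | nil => simp [Ring.lie_def]
    | cons i l ih =>
      have e : ⁅((i :: l).map E).prod, (m.map E).prod⁆ =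
          E i * ⁅(l.map E).prod, (m.map E).prod⁆ + ⁅E i, (m.map E).prod⁆ * (l.map E).prod := by
        rw [List.map_cons, List.prod_cons]
        simp only [Ring.lie_def]; noncomm_ring
      rw [e, List.map_cons, List.sum_cons]
      refine add_mem ?_ ?_
      · have := mul_mem_wordFilt (basic_mem_wordFilt (K := K) (E := E) (wt := wt) i) ih
        rwa [show wt i + (l.map wt).sum + (m.map wt).sum + 1 =
          wt i + ((l.map wt).sum + (m.map wt).sum + 1) by ring]
      · have := mul_mem_wordFilt (h2 i m) (prod_mem_wordFilt (l := l) le_rfl)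
        rwa [show wt i + (l.map wt).sum + (m.map wt).sum + 1 =
          wt i + (m.map wt).sum + 1 + (l.map wt).sum by ring]
  induction hx, hy using Submodule.span_induction₂ with
  | mem_mem x y hx hy =>
    obtain ⟨l, hl, rfl⟩ := hx
    obtain ⟨m, hm, rfl⟩ := hy
    exact wordFilt_anti (by omega) (h3 l m)
  | zero_left => simp [Ring.lie_def]
  | zero_right => simp [Ring.lie_def]
  | add_left x y z _ _ _ hx hy =>
    have e : ⁅x + y, z⁆ = ⁅x, z⁆ + ⁅y, z⁆ := by simp only [Ring.lie_def]; noncomm_ring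
    rw [e]; exact add_mem hx hy
  | add_right x y z _ _ _ hx hy =>
    have e : ⁅x, y + z⁆ = ⁅x, y⁆ + ⁅x, z⁆ := by simp only [Ring.lie_def]; noncomm_ring
    rw [e]; exact add_mem hx hy
  | smul_left c x y _ _ h =>
    have e : ⁅c • x, y⁆ = c • ⁅x, y⁆ := by simp [Ring.lie_def, smul_sub]
    rw [e]; exact Submodule.smul_mem _ c h
  | smul_right c x y _ _ h =>
    have e : ⁅x, c • y⁆ = c • ⁅x, y⁆ := by simp [Ring.lie_def, smul_sub]
    rw [e]; exact Submodule.smul_mem _ c h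

theorem wordFilt_zero (hgen : Algebra.adjoin K (Set.range E) = ⊤) : wordFilt K E wt 0 = ⊤ := by
  rw [eq_top_iff]
  rintro x -
  have hx : x ∈ Algebra.adjoin K (Set.range E) := by rw [hgen]; exact Algebra.mem_top
  induction hx using Algebra.adjoin_induction with
  | mem x hx =>
    obtain ⟨i, rfl⟩ := hx
    exact wordFilt_anti (Nat.zero_le (wt i)) (basic_mem_wordFilt i)
  | algebraMap c =>
    rw [Algebra.algebraMap_eq_smul_one]
    refine Submodule.smul_mem _ c ?_
    have := prod_mem_wordFilt (K := K) (E := E) (wt := wt) (l := []) (Nat.zero_le _)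
    rwa [List.map_nil, List.prod_nil] at this
  | add x y _ _ hx hy => exact add_mem hx hy
  | mul x y _ _ hx hy => exact mul_mem_wordFilt (p := 0) (q := 0) hx hy

include hE in
theorem commIdeal_le_wordFilt (hgen : Algebra.adjoin K (Set.range E) = ⊤) {i : ℕ} {x : A}
    (hx : x ∈ commIdeal A i) : x ∈ wordFilt K E wt i := by
  have h0 (a : A) : a ∈ wordFilt K E wt 0 := by
    rw [wordFilt_zero hgen]; trivial
  have hgenr {i : ℕ} {u : A} (hu : IsLeftComm i u) : u ∈ wordFilt K E wt i := by
    induction hu with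
    | base a => exact h0 a
    | step _ a ih =>
      have := lie_mem_wordFilt hE ih (h0 a)
      rwa [add_zero] at this
  refine commIdeal.induction (p := (· ∈ wordFilt K E wt i)) (zero_mem _)
    (fun x y hx hy => add_mem hx hy) (fun c u hu => ?_) hx
  have := mul_mem_wordFilt (h0 c) (hgenr hu)
  rwa [zero_add] at this

/-- The span of the products of less than `n` members of the family `E` of total weight at
least `p`. -/
def shortFilt (K : Type*) [Field K] [Algebra K A] (E : ι → A) (wt : ι → ℕ) (n p : ℕ) :
    Submodule K A :=
  Submodule.span K {x | ∃ l : List ι, l.length < n ∧ p ≤ (l.map wt).sum ∧ x = (l.map E).prod}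

theorem mul_mem_shortFilt {n p : ℕ} (i : ι) {x : A} (hx : x ∈ shortFilt K E wt n p) :
    E i * x ∈ shortFilt K E wt (n + 1) (wt i + p) := by
  induction hx using Submodule.span_induction with
  | mem x hx =>
    obtain ⟨l, hl, hp, rfl⟩ := hx
    exact Submodule.subset_span ⟨i :: l, by simpa using hl, by simpa using hp, by simp⟩
  | zero => simp
  | add x y _ _ hx hy => rw [mul_add]; exact add_mem hx hy
  | smul c x _ hx => rw [mul_smul_comm]; exact Submodule.smul_mem _ c hx

include hE in
-- Exchanging neighbours replaces two letters by single letters of larger weight.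
theorem prod_sub_prod_mem_shortFilt {l m : List ι} (h : l.Perm m) :
    (l.map E).prod - (m.map E).prod ∈ shortFilt K E wt l.length (l.map wt).sum := by
  induction h with
  | nil => simp
  | cons i h ih =>
    simp only [List.map_cons, List.prod_cons, List.sum_cons, List.length_cons, ← mul_sub]
    exact mul_mem_shortFilt i ih
  | swap i j l =>
    have e : ((j :: i :: l).map E).prod - ((i :: j :: l).map E).prod =
        ⁅E j, E i⁆ * (l.map E).prod := by
      simp only [List.map_cons, List.prod_cons, Ring.lie_def]; noncomm_ring
    rw [e]
    have hji := hE j i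
    generalize ⁅E j, E i⁆ = y at hji
    clear e
    induction hji using Submodule.span_induction with
    | mem x hx =>
      obtain ⟨k, hk, rfl⟩ := hx
      exact Submodule.subset_span ⟨k :: l, by simp, by simp; omega, by simp⟩
    | zero => simp
    | add x y _ _ hx hy => rw [add_mul]; exact add_mem hx hy
    | smul c x _ hx => rw [smul_mul_assoc]; exact Submodule.smul_mem _ c hx
  | @trans l₁ l₂ l₃ h₁ _ ih₁ ih₂ =>
    rw [← h₁.length_eq, ← (h₁.map wt).sum_eq] at ih₂
    simpa using add_mem ih₁ ih₂

include hE in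
theorem wordFilt_le_span_sorted [LinearOrder ι] (p : ℕ) : wordFilt K E wt p ≤
    Submodule.span K ((fun w : RegularIndex ι => (w.1.map E).prod) ''
      {w | p ≤ (w.1.map wt).sum}) := by
  have key (n : ℕ) : ∀ p, shortFilt K E wt n p ≤
      Submodule.span K ((fun w : RegularIndex ι => (w.1.map E).prod) ''
        {w | p ≤ (w.1.map wt).sum}) := by
    induction n with
    | zero =>
      refine fun p => Submodule.span_le.mpr ?_
      rintro _ ⟨l, hl, -⟩
      simp at hl
    | succ n ih =>
      refine fun p => Submodule.span_le.mpr ?_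
      rintro _ ⟨l, hl, hp, rfl⟩
      have hperm := (List.perm_insertionSort (· ≤ ·) l).symm
      have h := prod_sub_prod_mem_shortFilt hE hperm
      have h' : shortFilt K E wt l.length (l.map wt).sum ≤ shortFilt K E wt n p :=
        Submodule.span_mono fun _ ⟨m, h1, h2, h3⟩ => ⟨m, by omega, hp.trans h2, h3⟩
      rw [SetLike.mem_coe, ← sub_add_cancel (l.map E).prod ((l.insertionSort (· ≤ ·)).map E).prod]
      refine add_mem (ih p (h' h)) (Submodule.subset_span
        ⟨⟨_, List.pairwise_insertionSort (· ≤ ·) l⟩, ?_, rfl⟩)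
      simpa [← (hperm.map wt).sum_eq] using hp
  refine Submodule.span_le.mpr ?_
  rintro _ ⟨l, hp, rfl⟩
  exact key (l.length + 1) p (Submodule.subset_span ⟨l, Nat.lt_succ_self _, hp, rfl⟩)

end WordFiltration

theorem natCast_ne_zero_of_ringChar_ne {K : Type*} [Field K] {p : ℕ} (hp : p.Prime)
    (h : ringChar K ≠ p) : (p : K) ≠ 0 := by
  intro h0
  rcases (Nat.dvd_prime hp).mp ((ringChar.spec K p).mp h0) with h1 | h1
  · exact CharP.ringChar_ne_one h1
  · exact h h1

/-! ### From the free Lie algebra to associative algebras -/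

section LieHom

attribute [local instance] LieRing.ofAssociativeRing

variable {K X : Type*} [Field K]

theorem lieToAssoc_lie (u v : FreeLieAlgebra K X) :
    lieToAssoc K X ⁅u, v⁆ = ⁅lieToAssoc K X u, lieToAssoc K X v⁆ :=
  LieHom.map_lie (FreeLieAlgebra.lift K (FreeAlgebra.ι K : X → FreeAlgebra K X)) u v

theorem lieToAssoc_of (x : X) : lieToAssoc K X (FreeLieAlgebra.of K x) = FreeAlgebra.ι K x :=
  FreeLieAlgebra.lift_of_apply (L := FreeAlgebra K X) _ x

/-- A linear map from the free Lie algebra to an associative algebra which respects brackets factors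
through the free associative algebra. -/
theorem lift_lieToAssoc {B : Type*} [Ring B] [Algebra K B] (ρ : FreeLieAlgebra K X →ₗ[K] B)
    (h : ∀ u v, ρ ⁅u, v⁆ = ρ u * ρ v - ρ v * ρ u) (u : FreeLieAlgebra K X) :
    FreeAlgebra.lift K (fun x => ρ (FreeLieAlgebra.of K x)) (lieToAssoc K X u) = ρ u := by
  let F₁ : FreeLieAlgebra K X →ₗ⁅K⁆ B := { ρ with map_lie' := fun {u v} => h u v }
  let F₂ : FreeLieAlgebra K X →ₗ⁅K⁆ B :=
    { (FreeAlgebra.lift K (fun x => ρ (FreeLieAlgebra.of K x))).toLinearMap.comp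
        (lieToAssoc K X) with
      map_lie' := fun {u v} => by
        simp [lieToAssoc_lie, Ring.lie_def] }
  have : F₂ = F₁ := by
    refine FreeLieAlgebra.hom_ext fun x => ?_
    change FreeAlgebra.lift K (fun x => ρ (FreeLieAlgebra.of K x)) (lieToAssoc K X _) = ρ _
    rw [lieToAssoc_of, FreeAlgebra.lift_ι_apply]
  exact congrArg (fun F : FreeLieAlgebra K X →ₗ⁅K⁆ B => F u) this

end LieHom

/-! ### Regular words in the free algebra -/

section FreeLie

variable {K X ι : Type*} [Field K]

theorem IsLieMonomial.pos {d : ℕ} {u : FreeLieAlgebra K X} (h : IsLieMonomial K d u) : 1 ≤ d := by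
  induction h with
  | of => exact le_rfl
  | lie _ _ h1 h2 => omega

theorem eq_zero_of_mem_lieComponent_zero {u : FreeLieAlgebra K X}
    (h : u ∈ lieComponent K X 0) : u = 0 := by
  have : {u | IsLieMonomial K 0 u} = (∅ : Set (FreeLieAlgebra K X)) :=
    Set.eq_empty_of_forall_notMem fun u hu => absurd (IsLieMonomial.pos hu) (by simp)
  rw [lieComponent, this, Submodule.span_empty] at h
  exact (Submodule.mem_bot K).mp h

theorem lieToAssoc_mem_genCommSpan {d : ℕ} {u : FreeLieAlgebra K X}
    (h : u ∈ lieComponent K X d) :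
    lieToAssoc K X u ∈ genCommSpan K (FreeAlgebra.ι K : X → FreeAlgebra K X) (d - 1) := by
  suffices hs : lieComponent K X d ≤ (genCommSpan K (FreeAlgebra.ι K : X → FreeAlgebra K X)
      (d - 1)).comap (lieToAssoc K X) from hs h
  refine Submodule.span_le.mpr fun u hu => ?_
  change lieToAssoc K X u ∈ genCommSpan K _ (d - 1)
  change IsLieMonomial K d u at hu
  clear h
  induction hu with
  | of x => rw [lieToAssoc_of]; exact Submodule.subset_span (.base x)
  | @lie k l u v hu hv ihu ihv =>
    rw [lieToAssoc_lie]
    have hk := hu.pos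
    have hl := hv.pos
    have := lie_mem_genCommSpan ihu ihv
    rwa [show k - 1 + (l - 1) + 1 = k + l - 1 by omega] at this

theorem lie_mem_lieComponent {k l : ℕ} {u v : FreeLieAlgebra K X} (hu : u ∈ lieComponent K X k)
    (hv : v ∈ lieComponent K X l) : ⁅u, v⁆ ∈ lieComponent K X (k + l) := by
  induction hu, hv using Submodule.span_induction₂ with
  | mem_mem u v hu hv => exact Submodule.subset_span (IsLieMonomial.lie hu hv)
  | zero_left => simp
  | zero_right => simp
  | add_left x y z _ _ _ hx hy => rw [add_lie]; exact add_mem hx hy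
  | add_right x y z _ _ _ hx hy => rw [lie_add]; exact add_mem hx hy
  | smul_left c x y _ _ h => rw [smul_lie]; exact Submodule.smul_mem _ c h
  | smul_right c x y _ _ h => rw [lie_smul]; exact Submodule.smul_mem _ c h

/-- The endomorphism of the free Lie algebra which multiplies the generators by `t`. -/
noncomputable def lieScale (t : K) : FreeLieAlgebra K X →ₗ⁅K⁆ FreeLieAlgebra K X :=
  FreeLieAlgebra.lift K fun x => t • FreeLieAlgebra.of K x

theorem lieScale_of_mem {d : ℕ} {u : FreeLieAlgebra K X} (h : u ∈ lieComponent K X d) (t : K) :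
    lieScale t u = t ^ d • u := by
  induction h using Submodule.span_induction with
  | mem u hu =>
    change IsLieMonomial K d u at hu
    induction hu with
    | of x => rw [lieScale, FreeLieAlgebra.lift_of_apply, pow_one]
    | lie _ _ h1 h2 => rw [LieHom.map_lie, h1, h2, smul_lie, lie_smul, smul_smul, pow_add]
  | zero => simp
  | add x y _ _ hx hy => rw [map_add, hx, hy, smul_add]
  | smul c x _ hx => rw [map_smul, hx, smul_comm]

/-- Scaling the generators by t multiplies the k-th coordinate by t ^ deg k and u by t ^ d. Equality
for all t in an infinite field is equality of polynomials. -/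
theorem degree_eq_of_repr_ne_zero [Infinite K] {e : Module.Basis ι K (FreeLieAlgebra K X)}
    {deg : ι → ℕ} (hdeg : ∀ i, e i ∈ lieComponent K X (deg i)) {d : ℕ} {u : FreeLieAlgebra K X}
    (h : u ∈ lieComponent K X d) {k : ι} (hk : e.repr u k ≠ 0) : deg k = d := by
  have h1 (t : K) : e.repr (lieScale t u) k = t ^ deg k * e.repr u k := by
    have : (Finsupp.lapply k ∘ₗ e.repr.toLinearMap) ∘ₗ
        (lieScale t : FreeLieAlgebra K X →ₗ⁅K⁆ FreeLieAlgebra K X).toLinearMap =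
        t ^ deg k • (Finsupp.lapply k ∘ₗ e.repr.toLinearMap) := by
      refine e.ext fun i => ?_
      by_cases hik : i = k
      · subst hik; simp [lieScale_of_mem (hdeg i)]
      · simp [lieScale_of_mem (hdeg i), hik]
    simpa using congrArg (fun f : FreeLieAlgebra K X →ₗ[K] K => f u) this
  have h2 : (Polynomial.X ^ deg k : Polynomial K) = Polynomial.X ^ d := by
    refine Polynomial.funext fun t => ?_
    have := h1 t
    rw [lieScale_of_mem h, map_smul, Finsupp.smul_apply, smul_eq_mul] at this
    simpa using (mul_right_cancel₀ hk this).symm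
  simpa using congrArg Polynomial.natDegree h2

theorem adjoin_range_lieToAssoc (e : Module.Basis ι K (FreeLieAlgebra K X)) :
    Algebra.adjoin K (Set.range fun i => lieToAssoc K X (e i)) = ⊤ := by
  rw [eq_top_iff, ← FreeAlgebra.adjoin_range_ι, Algebra.adjoin_le_iff]
  rintro _ ⟨x, rfl⟩
  have : FreeLieAlgebra.of K x ∈ Submodule.span K (Set.range e) := e.mem_span _
  have := Submodule.mem_map_of_mem (f := lieToAssoc K X) this
  rw [lieToAssoc_of, Submodule.map_span, ← Set.range_comp] at this
  exact Algebra.span_le_adjoin K _ this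

theorem degree_pos {e : Module.Basis ι K (FreeLieAlgebra K X)}
    {deg : ι → ℕ} (hdeg : ∀ i, e i ∈ lieComponent K X (deg i)) (i : ι) : 1 ≤ deg i := by
  by_contra h
  have h0 : deg i = 0 := by omega
  exact e.ne_zero i (eq_zero_of_mem_lieComponent_zero (h0 ▸ hdeg i))

theorem lie_basis_mem_span [Infinite K] {e : Module.Basis ι K (FreeLieAlgebra K X)}
    {deg : ι → ℕ} (hdeg : ∀ i, e i ∈ lieComponent K X (deg i)) (i j : ι) :
    ⁅lieToAssoc K X (e i), lieToAssoc K X (e j)⁆ ∈ Submodule.span K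
      {x | ∃ k, (deg i - 1) + (deg j - 1) + 1 ≤ deg k - 1 ∧ x = lieToAssoc K X (e k)} := by
  rw [← lieToAssoc_lie, ← e.linearCombination_repr ⁅e i, e j⁆, Finsupp.linearCombination_apply,
    Finsupp.sum, map_sum]
  refine Submodule.sum_mem _ fun k hk => ?_
  rw [map_smul]
  refine Submodule.smul_mem _ _ (Submodule.subset_span ⟨k, ?_, rfl⟩)
  have := degree_eq_of_repr_ne_zero hdeg (lie_mem_lieComponent (hdeg i) (hdeg j))
    (Finsupp.mem_support_iff.mp hk)
  have h1 := degree_pos hdeg i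
  have h2 := degree_pos hdeg j
  omega

variable [LinearOrder ι]

/-- Applied to the empty monomial, a sorted word acts by plain multiplication, so it yields the
monomial of its letters; distinct sorted words yield distinct monomials. -/
theorem linearIndependent_regularWord (e : Module.Basis ι K (FreeLieAlgebra K X)) :
    LinearIndependent K (regularWord e) := by
  let Φ : FreeAlgebra K X →ₐ[K] Module.End K (PBWSpace K ι) :=
    FreeAlgebra.lift K fun x => pbwLin e (FreeLieAlgebra.of K x)
  have hΦ (u) : Φ (lieToAssoc K X u) = pbwLin e u :=
    lift_lieToAssoc (B := Module.End K (PBWSpace K ι)) (pbwLin e) (pbwLin_lie e) u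
  let ev : FreeAlgebra K X →ₗ[K] PBWSpace K ι :=
    (LinearMap.applyₗ (Finsupp.single 0 1)).comp Φ.toLinearMap
  have hev (w : RegularIndex ι) : ev (regularWord e w) = Finsupp.single (w.1 : Multiset ι) 1 := by
    obtain ⟨l, hl⟩ := w
    change Φ _ _ = _
    rw [regularWord]
    induction l with
    | nil => simp
    | cons i l ih =>
      rw [List.pairwise_cons] at hl
      rw [List.map_cons, List.prod_cons, map_mul, Module.End.mul_apply, ih hl.2, hΦ,
        pbwLin_of_le e (by simpa using hl.1)]
      rfl
  refine LinearIndependent.of_comp ev ?_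
  have : ev ∘ regularWord e =
      (fun M : Multiset ι => Finsupp.single M (1 : K)) ∘ fun w : RegularIndex ι => ↑w.1 :=
    funext hev
  rw [this]
  refine LinearIndependent.comp ?_ _ ?_
  · simpa using (Finsupp.basisSingleOne (R := K) (ι := Multiset ι)).linearIndependent
  · rintro ⟨l, hl⟩ ⟨m, hm⟩ h
    exact Subtype.ext ((Multiset.coe_eq_coe.mp h).eq_of_pairwise
      (fun a b _ _ => le_antisymm) hl hm)

theorem wordWeight_eq {deg : ι → ℕ} (h : ∀ i, 1 ≤ deg i) (w : RegularIndex ι) :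
    wordWeight deg w = (w.1.map fun i => deg i - 1).sum + 1 := by
  have (l : List ι) : (l.map deg).sum = (l.map fun i => deg i - 1).sum + l.length := by
    induction l with
    | nil => rfl
    | cons i l ih =>
      have := h i
      simp only [List.map_cons, List.sum_cons, List.length_cons, ih]; omega
  rw [wordWeight, this]; omega

theorem commIdeal_le_span_regularWord [Infinite K] {e : Module.Basis ι K (FreeLieAlgebra K X)}
    {deg : ι → ℕ} (hdeg : ∀ i, e i ∈ lieComponent K X (deg i)) {i : ℕ} {f : FreeAlgebra K X}
    (hf : f ∈ commIdeal (FreeAlgebra K X) i) :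
    f ∈ Submodule.span K (regularWord e '' {w | i + 1 ≤ wordWeight deg w}) := by
  have := wordFilt_le_span_sorted (lie_basis_mem_span hdeg) i
    (commIdeal_le_wordFilt (lie_basis_mem_span hdeg) (adjoin_range_lieToAssoc e) hf)
  simp only [wordWeight_eq (degree_pos hdeg), Nat.add_le_add_iff_right]
  exact this

theorem span_regularWord_eq_top [Infinite K] {e : Module.Basis ι K (FreeLieAlgebra K X)}
    {deg : ι → ℕ} (hdeg : ∀ i, e i ∈ lieComponent K X (deg i)) :
    Submodule.span K (Set.range (regularWord e)) = ⊤ := by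
  rw [eq_top_iff]
  exact fun f _ => Submodule.span_mono (Set.image_subset_range _ _)
    (commIdeal_le_span_regularWord hdeg (mem_zero f))

theorem regularWord_mem_commIdeal (h2 : ringChar K ≠ 2) (h3 : ringChar K ≠ 3)
    {e : Module.Basis ι K (FreeLieAlgebra K (Fin 3))} {deg : ι → ℕ}
    (hdeg : ∀ i, e i ∈ lieComponent K (Fin 3) (deg i)) {n : ℕ} {w : RegularIndex ι}
    (hw : n + 1 ≤ wordWeight deg w) : regularWord e w ∈ commIdeal (FreeAlgebra K (Fin 3)) n := by
  have unit {p : ℕ} (hp : p.Prime) (h : ringChar K ≠ p) :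
      IsUnit (p : FreeAlgebra K (Fin 3)) := by
    rw [← map_natCast (algebraMap K (FreeAlgebra K (Fin 3)))]
    exact (natCast_ne_zero_of_ringChar_ne hp h).isUnit.map _
  have := list_prod_mem_commIdeal (K := K) (unit Nat.prime_two h2) (unit Nat.prime_three h3) _
    (w.1.map fun i => (deg i - 1, lieToAssoc K (Fin 3) (e i))) rfl
    (by simpa using fun i _ => lieToAssoc_mem_genCommSpan (hdeg i))
  rw [List.map_map, List.map_map] at this
  rw [wordWeight_eq (degree_pos hdeg), Nat.add_le_add_iff_right] at hw
  exact antitone hw this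

end FreeLie

/-! ### Identities of the relatively free algebra -/

section RelFree

theorem IsLeftComm.map {A B : Type*} [Ring A] [Ring B] (φ : A →+* B) {i : ℕ} {u : A}
    (hu : IsLeftComm i u) : IsLeftComm i (φ u) := by
  induction hu with
  | base a => exact .base _
  | step _ a ih =>
    have : ∀ x y : A, φ ⁅x, y⁆ = ⁅φ x, φ y⁆ := fun x y => by simp [Ring.lie_def]
    rw [this]
    exact ih.step _

theorem commIdeal.map_mem {A B : Type*} [Ring A] [Ring B] (φ : A →+* B) {i : ℕ} {x : A}
    (hx : x ∈ commIdeal A i) : φ x ∈ commIdeal B i := by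
  refine commIdeal.induction (p := fun x => φ x ∈ commIdeal B i) (by simp) (fun x y hx hy => ?_)
    (fun c u hu => ?_) hx
  · rw [map_add]; exact add_mem hx hy
  · rw [map_mul]; exact mul_left _ (hu.map φ).mem

theorem leftComm_congr {A : Type*} [Ring A] {a b : ℕ → A} {k : ℕ} (h : ∀ i ≤ k, a i = b i) :
    leftComm a k = leftComm b k := by
  induction k with
  | zero => exact h 0 le_rfl
  | succ k ih => simp only [leftComm, ih fun i hi => h i (by omega), h (k + 1) le_rfl]

theorem isLeftComm_leftComm {A : Type*} [Ring A] (a : ℕ → A) (k : ℕ) :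
    IsLeftComm k (leftComm a k) := by
  induction k with
  | zero => exact .base _
  | succ k ih => exact ih.step (a (k + 1))

theorem IsLeftComm.exists_leftComm {A : Type*} [Ring A] {k : ℕ} {u : A} (hu : IsLeftComm k u) :
    ∃ a : ℕ → A, u = leftComm a k := by
  induction hu with
  | base a => exact ⟨fun _ => a, rfl⟩
  | @step k u _ b ih =>
    obtain ⟨a, rfl⟩ := ih
    refine ⟨fun i => if i ≤ k then a i else b, ?_⟩
    rw [leftComm, leftComm_congr (a := fun i => if i ≤ k then a i else b) (b := a)
      fun i hi => if_pos hi]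
    simp [Ring.lie_def]

theorem map_leftComm {A B : Type*} [Ring A] [Ring B] (φ : A →+* B) (a : ℕ → A) (k : ℕ) :
    φ (leftComm a k) = leftComm (fun i => φ (a i)) k := by
  induction k with
  | zero => rfl
  | succ k ih => simp [leftComm, ih]

variable {K : Type*} [Field K]

/-- The canonical homomorphism `F → F^(n)`. -/
def relMk (K : Type*) [Field K] (n : ℕ) : FreeAlgebra K ℕ →ₐ[K] RelFree K n :=
  { (lieNilpIdeal K n).ringCon.mk' with commutes' := fun _ => rfl }

theorem relMk_surjective (n : ℕ) : Function.Surjective (relMk K n) :=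
  Quotient.mk''_surjective

theorem relMk_eq_zero {n : ℕ} {f : FreeAlgebra K ℕ} :
    relMk K n f = 0 ↔ f ∈ lieNilpIdeal K n := by
  rw [← sub_zero f, ← TwoSidedIdeal.rel_iff, ← RingCon.eq, sub_zero]
  rfl

theorem map_mem_lieNilpIdeal {n : ℕ} (φ : FreeAlgebra K ℕ →ₐ[K] FreeAlgebra K ℕ)
    {f : FreeAlgebra K ℕ} (hf : f ∈ lieNilpIdeal K n) : φ f ∈ lieNilpIdeal K n := by
  rw [lieNilpIdeal, tIdealSpan, TwoSidedIdeal.mem_sInf] at hf ⊢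
  exact fun I hI => hI.1 φ f (hf I hI)

theorem leftComm_mem_lieNilpIdeal (n : ℕ) (a : ℕ → FreeAlgebra K ℕ) :
    leftComm a (n - 1) ∈ lieNilpIdeal K n := by
  have h : leftComm (fun i => FreeAlgebra.ι K i) (n - 1) ∈ lieNilpIdeal K n := by
    rw [lieNilpIdeal, tIdealSpan, TwoSidedIdeal.mem_sInf]
    exact fun I hI => hI.2 rfl
  have := map_mem_lieNilpIdeal (FreeAlgebra.lift K a) h
  rw [← AlgHom.coe_toRingHom, map_leftComm] at this
  simpa using this

theorem eq_zero_of_mem_commIdeal {A : Type*} [Ring A] {k : ℕ}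
    (h : ∀ a : ℕ → A, leftComm a k = 0) {x : A} (hx : x ∈ commIdeal A k) : x = 0 := by
  refine commIdeal.induction (p := fun y : A => y = 0) rfl
    (fun x y hx hy => by rw [hx, hy, add_zero])
    (fun c u hu => ?_) hx
  obtain ⟨a, rfl⟩ := hu.exists_leftComm
  rw [h, mul_zero]

theorem leftComm_relFree_eq_zero {n : ℕ} (a : ℕ → RelFree K n) : leftComm a (n - 1) = 0 := by
  choose b hb using fun i => relMk_surjective n (a i)
  obtain rfl : (fun i => relMk K n (b i)) = a := funext hb
  exact (map_leftComm (relMk K n).toRingHom b (n - 1)).symm.trans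
    (relMk_eq_zero.mpr (leftComm_mem_lieNilpIdeal n b))

/-- The elements of `F` all of whose images in `A` lie in the ideal generated by the left-normed
commutators of `k + 1` elements. -/
def homCommIdeal (K : Type*) [Field K] (A : Type*) [Ring A] [Algebra K A] (k : ℕ) :
    TwoSidedIdeal (FreeAlgebra K ℕ) :=
  TwoSidedIdeal.mk' {g | ∀ φ : FreeAlgebra K ℕ →ₐ[K] A, φ g ∈ commIdeal A k}
    (fun φ => by simp) (fun hx hy φ => by rw [map_add]; exact add_mem (hx φ) (hy φ))
    (fun hx φ => by rw [map_neg]; exact neg_mem (hx φ))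
    (fun hy φ => by rw [map_mul]; exact mul_left _ (hy φ))
    (fun hx φ => by rw [map_mul]; exact mul_right (hx φ) _)

theorem mem_homCommIdeal {A : Type*} [Ring A] [Algebra K A] {k : ℕ} {g : FreeAlgebra K ℕ} :
    g ∈ homCommIdeal K A k ↔ ∀ φ : FreeAlgebra K ℕ →ₐ[K] A, φ g ∈ commIdeal A k :=
  TwoSidedIdeal.mem_mk' ..

/-- `homCommIdeal` is a T-ideal containing the defining commutator, hence contains T^(n). -/
theorem map_mem_commIdeal_of_mem_lieNilpIdeal {A : Type*} [Ring A] [Algebra K A] {n : ℕ}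
    {f : FreeAlgebra K ℕ} (hf : f ∈ lieNilpIdeal K n) (φ : FreeAlgebra K ℕ →ₐ[K] A) :
    φ f ∈ commIdeal A (n - 1) := by
  rw [lieNilpIdeal, tIdealSpan, TwoSidedIdeal.mem_sInf] at hf
  refine mem_homCommIdeal.mp (hf (homCommIdeal K A (n - 1)) ⟨fun ψ a ha => ?_, ?_⟩) φ
  · exact mem_homCommIdeal.mpr fun φ => mem_homCommIdeal.mp ha (φ.comp ψ)
  · rintro _ rfl
    exact mem_homCommIdeal.mpr fun φ => commIdeal.map_mem φ.toRingHom
      (isLeftComm_leftComm _ _).mem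

theorem mem_commIdeal_of_toRelFree_eq_zero {n : ℕ} {f : FreeAlgebra K (Fin 3)}
    (hf : toRelFree K n f = 0) : f ∈ commIdeal (FreeAlgebra K (Fin 3)) (n - 1) := by
  let j : FreeAlgebra K (Fin 3) →ₐ[K] FreeAlgebra K ℕ :=
    FreeAlgebra.lift K fun i => FreeAlgebra.ι K (i : ℕ)
  -- A retraction; reducing indices modulo 3 is arbitrary beyond the first three generators.
  let r : FreeAlgebra K ℕ →ₐ[K] FreeAlgebra K (Fin 3) :=
    FreeAlgebra.lift K fun i => FreeAlgebra.ι K (Fin.ofNat 3 i)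
  have h1 : toRelFree K n = (relMk K n).comp j := by
    refine FreeAlgebra.hom_ext (funext fun i => ?_)
    simp [toRelFree, j, relGen]
    rfl
  have h2 : r.comp j = AlgHom.id K _ := by
    refine FreeAlgebra.hom_ext (funext fun i => ?_)
    simp [r, j]
  rw [h1, AlgHom.comp_apply, relMk_eq_zero] at hf
  have := map_mem_commIdeal_of_mem_lieNilpIdeal hf r
  rwa [← AlgHom.comp_apply, h2] at this

theorem isIdentity_relFree_iff {n : ℕ} {f : FreeAlgebra K (Fin 3)} :
    IsIdentity f (RelFree K n) ↔ f ∈ commIdeal (FreeAlgebra K (Fin 3)) (n - 1) :=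
  ⟨fun h => mem_commIdeal_of_toRelFree_eq_zero (h _),
    fun h a => eq_zero_of_mem_commIdeal leftComm_relFree_eq_zero
      (commIdeal.map_mem (FreeAlgebra.lift K a).toRingHom h)⟩

theorem toRelFree_eq_zero_iff {n : ℕ} {f : FreeAlgebra K (Fin 3)} :
    toRelFree K n f = 0 ↔ f ∈ commIdeal (FreeAlgebra K (Fin 3)) (n - 1) :=
  ⟨mem_commIdeal_of_toRelFree_eq_zero, fun h => isIdentity_relFree_iff.mpr h _⟩

theorem range_toRelFree (n : ℕ) : (toRelFree K n).range = relFreeThree K n := by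
  rw [← Algebra.map_top, ← FreeAlgebra.adjoin_range_ι, AlgHom.map_adjoin, ← Set.range_comp,
    relFreeThree]
  congr 2
  funext i
  simp [toRelFree]

end RelFree

/-! ### The main theorem -/

theorem mainTheorem2 {K : Type*} [Field K] [Infinite K] (h2 : ringChar K ≠ 2)
    (h3 : ringChar K ≠ 3) (n : ℕ) (hn : 2 ≤ n)
    {ι : Type*} [LinearOrder ι]
    (e : Module.Basis ι K (FreeLieAlgebra K (Fin 3)))
    (deg : ι → ℕ) (hdeg : ∀ i, e i ∈ lieComponent K (Fin 3) (deg i))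
    (horder : ∀ i j, deg j < deg i → i < j) :
    ∃ B : Module.Basis (RegularIndex ι) K (FreeAlgebra K (Fin 3)),
      (∀ w, B w = regularWord e w) ∧
      (∀ f : FreeAlgebra K (Fin 3), IsIdentity f (RelFree K n) ↔ (n : ℕ∞) ≤ weight deg B f) ∧
      LinearIndependent K
        (fun w : {w : RegularIndex ι // wordWeight deg w < n} =>
          toRelFree K n (regularWord e w.1)) ∧
      Submodule.span K
        (Set.range fun w : {w : RegularIndex ι // wordWeight deg w < n} =>
          toRelFree K n (regularWord e w.1)) =
        Subalgebra.toSubmodule (relFreeThree K n) := by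
  have hli := linearIndependent_regularWord e
  let B := Module.Basis.mk hli (span_regularWord_eq_top hdeg).ge
  have hB : ⇑B = regularWord e := Module.Basis.coe_mk _ _
  have hn1 : n - 1 + 1 = n := by omega
  have hword {w : RegularIndex ι} (hw : n ≤ wordWeight deg w) :
      regularWord e w ∈ commIdeal (FreeAlgebra K (Fin 3)) (n - 1) :=
    regularWord_mem_commIdeal h2 h3 hdeg (hn1.symm ▸ hw)
  have hmem (f : FreeAlgebra K (Fin 3)) : f ∈ commIdeal (FreeAlgebra K (Fin 3)) (n - 1) ↔
      f ∈ Submodule.span K (regularWord e '' {w | n ≤ wordWeight deg w}) := by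
    refine ⟨fun hf => ?_, fun hf => ?_⟩
    · simpa only [hn1] using commIdeal_le_span_regularWord hdeg hf
    · induction hf using Submodule.span_induction with
      | mem x hx => obtain ⟨w, hw, rfl⟩ := hx; exact hword hw
      | zero => exact zero_mem _
      | add x y _ _ hx hy => exact add_mem hx hy
      | smul c x _ hx => exact commIdeal.smul_mem c hx
  refine ⟨B, fun w => congrFun hB w, fun f => ?_, ?_, ?_⟩
  · rw [isIdentity_relFree_iff, hmem, ← hB, B.mem_span_image, weight, Finset.le_inf_iff]
    simp [Set.subset_def]
  · refine (hli.comp _ Subtype.val_injective).map (f := (toRelFree K n).toLinearMap) ?_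
    -- The kernel of `toRelFree` is the span of the words of weight at least n, which meets the span
    -- of the others trivially.
    have hd : Disjoint {w : RegularIndex ι | wordWeight deg w < n} {w | n ≤ wordWeight deg w} :=
      Set.disjoint_left.mpr fun w h h' => not_lt.mpr (show n ≤ wordWeight deg w from h') h
    refine (hli.disjoint_span_image hd).mono (Submodule.span_mono ?_) fun f hf => ?_
    · rintro _ ⟨w, rfl⟩
      exact ⟨w.1, w.2, rfl⟩
    · exact (hmem f).mp (toRelFree_eq_zero_iff.mp hf)
  · rw [← range_toRelFree]
    refine le_antisymm (Submodule.span_le.mpr ?_) ?_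
    · rintro _ ⟨w, rfl⟩
      exact ⟨_, rfl⟩
    · rintro _ ⟨f, rfl⟩
      have hf : f ∈ Submodule.span K (Set.range (regularWord e)) := by
        rw [span_regularWord_eq_top hdeg]; trivial
      induction hf using Submodule.span_induction with
      | mem x hx =>
        obtain ⟨w, rfl⟩ := hx
        by_cases hw : wordWeight deg w < n
        · exact Submodule.subset_span ⟨⟨w, hw⟩, rfl⟩
        · have := toRelFree_eq_zero_iff.mpr (hword (not_lt.mp hw))
          change toRelFree K n _ ∈ _
          rw [this]; exact zero_mem _
      | zero => simp
      | add x y _ _ hx hy => simpa using add_mem hx hy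
      | smul c x _ hx => simpa using Submodule.smul_mem _ c hx
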